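/- Let $K$ be a field and $t\in K$ a nonzero element that is not a root of unity (for instance an indeterminate $t=q^{1/4}$ over $\mathbb{Q}$, so that the identities below are identities in $q^{1/4}$). Put $q=t^4$ and $q^{r}=t^{4r}$ for $r\in\frac14\mathbb{Z}$. *Notation.* $(q)_n=\prod_{j=1}^{n}(1-q^j)$ for $n\ge 0$, and $1/(q)_n=0$ for $n<0$. The $q$-binomial $\left[{N\atop m}\right]_q$ equals $\frac{(q)_N}{(q)_m(q)_{N-m}}$ if $m$ and $N-m$ are nonnegative integers, and $0$ otherwise (in particular if $N\notin\mathbb{Z}$). For integers $L\ge 0$, $A$, $n$ the $q$-trinomial is $$\binom{L,q}{A}^{n}=\sum_{j\ge 0}q^{j(j+A-n)}\frac{(q)_L}{(q)_j(q)_{j+A}(q)_{L-2j-A}}\quad(|A|\le L),\qquad \binom{L,q}{A}^{n}=0\quad(|A|>L).$$ Let $\delta_{a,b}$ be Kronecker's delta, let $\theta(S)$ be $1$ if $S$ is true and $0$ otherwise, and let $\tilde p(n)\in\{0,1\}$ be the parity of $n$. Fix an integer $p\ge 4$. Vectors $\mathbf m=(m_0,\dots,m_{p-2})$ and matrices are indexed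 by $0,\dots,p-2$; $\mathbf e_a$ is the $a$-th unit vector, with $\mathbf e_{p-1}=0$. The matrix $\tilde I=\tilde I_{p-1}$ is given by $\tilde I_{0,j}=-\tilde I_{j,0}=-\delta_{j,2}$ for $0\le j\le p-2$ and $\tilde I_{i,j}=\delta_{i,j+1}+\delta_{i,j-1}$ for $1\le i,j\le p-2$, and $\tilde C=2-\tilde I$. Define $$f^p_k(L;\mathbf u;\mathbf A)=\sum_{\mathbf m\in\mathbb{Z}^{p-1},\ m_{p-2}\equiv k\,(2)}q^{\frac14\mathbf m\tilde C\mathbf m-\frac12\mathbf A\cdot\mathbf m}\prod_{j=0}^{p-2}\left[{\left(\frac12\tilde I\mathbf m+L\mathbf e_0+\frac12\mathbf u\right)_j\atop m_j}\right]_q ,$$ $$\mathbf u_{a,b}=\theta(a>1)\mathbf e_a+\theta(b>1)\mathbf e_b+\tilde p(a+\delta_{a,1}+b+\delta_{b,1})(\mathbf e_1-\mathbf e_0),$$ $$\mathbf A_{a,b}=\theta(b>1)\mathbf e_b+\tilde p(a+\delta_{a,1}+b+\delta_{b,1})\,\mathbf e_1 ,$$ $$F^{p,0}_{a,b}(L)=f^p_{k}(L;\mathbf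 u_{a,b};\mathbf A_{a,b}),\qquad k=0\ \text{if } b\ne p-1,\quad k=1\ \text{if } b=p-1 ,$$ and, with $p'=p+1$, $$B^p_{a,b}(L,s)=\sum_{j\in\mathbb{Z}}\left\{q^{pp'j^2+j(p'a-ps)}\binom{L,q}{2pj+a-b}^{0}-q^{(pj+a)(p'j+s)}\binom{L,q}{2pj+a+b}^{0}\right\},$$ $$\tilde B^p_{a,b}(L,s)=\sum_{j\in\mathbb{Z}}\left\{q^{pp'j^2+j(p'a-ps)}\binom{L,q}{2pj+a-b}^{1}-q^{pp'j^2+j(p'a+p(s-2))+a(s-1)-b}\binom{L,q}{2pj+a+b}^{1}\right\},$$ $$\varphi(a,b)=\tfrac14(b-a)(b-a+1),\qquad \tilde\varphi(a,b)=\tfrac14(b-a)(b-a+3).$$ *Theorem (even identities).* Let $L\ge 0$, $p\ge 4$ and $1\le a\le p-2$ be integers. For $1\le b\le p-1$ the sum defining $F^{p,0}_{a,b}(L)$ has only finitely many nonzero terms. Moreover $$F^{p,0}_{a,1}(L)=\begin{cases}q^{a(a-1)/4}\,B^p_{a,1}(L,1)&\text{if } a+\delta_{a,1}\text{ is even},\\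 q^{(a-1)(a-2)/4}\,B^p_{a,1}(L,2)&\text{if } a+\delta_{a,1}\text{ is odd},\end{cases}$$ and for $2\le b\le p-1$ $$F^{p,0}_{a,b}(L)=\begin{cases}q^{\varphi(a,b)}\,B^p_{a,b}(L,b+1)&\text{if } b+a+\delta_{a,1}\text{ is even},\\ q^{\tilde\varphi(a,b)}\,\tilde B^p_{a,b}(L,b+2)&\text{if } b+a+\delta_{a,1}\text{ is odd}.\end{cases}$$ In particular (the case $a=b=1$) $$\sum_{\mathbf m\in\mathbb{Z}^{p-1},\ m_{p-2}\equiv 0\,(2)}q^{\frac14\mathbf m\tilde C\mathbf m}\prod_{j=0}^{p-2}\left[{\left(\frac12\tilde I\mathbf m+L\mathbf e_0\right)_j\atop m_j}\right]_q=\sum_{j\in\mathbb{Z}}\left\{q^{pp'j^2+j}\binom{L,q}{2pj}^{0}-q^{(jp+1)(jp'+1)}\binom{L,q}{2pj+2}^{0}\right\}.$$ -/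

import Mathlib

namespace PhiTwoOne

variable {K : Type*} [Field K]

/-- The shifted factorial `(a; q)_n = ∏_{j < n} (1 - a q ^ j)` for `n ≥ 0`. -/
def qPoch (a q : K) (n : ℕ) : K := ∏ j ∈ Finset.range n, (1 - a * q ^ j)

/-- The reciprocal `1 / (a; q)_k` of the shifted factorial with an integer index; for `k < 0` it is
`∏_{j = 1}^{-k} (1 - a q ^ (-j))`. In particular `1 / (q; q)_k = 0` for `k < 0`. -/
noncomputable def qPochRecip (a q : K) (k : ℤ) : K :=
  if 0 ≤ k then (qPoch a q k.toNat)⁻¹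
  else ∏ j ∈ Finset.Icc 1 (-k).toNat, (1 - a * q ^ (-(j : ℤ)))

theorem qPochRecip_of_neg {q : K} (hq : q ≠ 0) {k : ℤ} (hk : k < 0) : qPochRecip q q k = 0 := by
  rw [qPochRecip, if_neg (by omega)]
  refine Finset.prod_eq_zero (i := 1) (Finset.mem_Icc.2 ⟨le_refl _, by omega⟩) ?_
  simp [hq]

/-- The Andrews-Baxter `q`-trinomial coefficient with lower entry `A` and superscript `n`:
`∑_{j ≥ 0} q ^ (j (j + A - n)) (q)_L / ((q)_j (q)_{j+A} (q)_{L-2j-A})` if `|A| ≤ L`, and `0` otherwise.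
The terms with `j > L` vanish, since then `L - 2 j - A < 0`. -/
noncomputable def qTrinomial (q : K) (n : ℤ) (L : ℕ) (A : ℤ) : K :=
  if |A| ≤ (L : ℤ) then
    ∑ j ∈ Finset.range (L + 1),
      q ^ ((j : ℤ) * ((j : ℤ) + A - n)) * qPoch q q L * (qPoch q q j)⁻¹ *
        qPochRecip q q ((j : ℤ) + A) * qPochRecip q q ((L : ℤ) - 2 * j - A)
  else 0

/-- The `q`-binomial coefficient with upper entry `N` and lower entry `m`:
`(q)_N / ((q)_m (q)_{N-m})` if `m` and `N - m` are nonnegative integers, and `0` otherwise. -/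
noncomputable def qBinomial (q : K) (N m : ℤ) : K :=
  if 0 ≤ m ∧ 0 ≤ N - m then
    qPoch q q N.toNat / (qPoch q q m.toNat * qPoch q q (N - m).toNat)
  else 0

/-- The `q`-binomial coefficient whose upper entry is the half-integer `N / 2`; it vanishes
when `N / 2` is not an integer. -/
noncomputable def qBinomialHalf (q : K) (N m : ℤ) : K :=
  if Even N then qBinomial q (N / 2) m else 0

/-- The matrix `Ĩ_{p-1}`, with rows and columns indexed by `0, …, p - 2`. -/
def incidence (p : ℕ) : Matrix (Fin (p - 1)) (Fin (p - 1)) ℤ := fun i j =>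
  if (i : ℕ) = 0 then (if (j : ℕ) = 2 then -1 else 0)
  else if (j : ℕ) = 0 then (if (i : ℕ) = 2 then 1 else 0)
  else (if (i : ℕ) = (j : ℕ) + 1 then 1 else 0) + (if (i : ℕ) + 1 = (j : ℕ) then 1 else 0)

/-- The matrix `C̃_{p-1} = 2 - Ĩ_{p-1}`. -/
def cartan (p : ℕ) : Matrix (Fin (p - 1)) (Fin (p - 1)) ℤ :=
  (2 : ℤ) • (1 : Matrix (Fin (p - 1)) (Fin (p - 1)) ℤ) - incidence p

/-- The unit vector `e_a` with coordinates indexed by `0, …, p - 2`; it is zero if `a ≥ p - 1`. -/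
def unitVec (p a : ℕ) : Fin (p - 1) → ℤ := fun j => if (j : ℕ) = a then 1 else 0

/-- The summand of the fundamental fermionic form, with `q = t ^ 4`, so that `q ^ (r / 4) = t ^ r`.
It is `q ^ (m C̃ m / 4 - A · m / 2) ∏_j [((1/2) Ĩ m + L e_0 + (1/2) u)_j ; m_j]_q` if
`m_{p-2} ≡ k (mod 2)`, and `0` otherwise. -/
noncomputable def fermionicTerm (t : K) (p : ℕ) (k : ℤ) (L : ℕ) (u A m : Fin (p - 1) → ℤ) : K :=
  if ∀ j : Fin (p - 1), (j : ℕ) + 2 = p → m j ≡ k [ZMOD 2] then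
    t ^ (m ⬝ᵥ (cartan p).mulVec m - 2 * (A ⬝ᵥ m)) *
      ∏ j : Fin (p - 1),
        qBinomialHalf (t ^ 4) (((incidence p).mulVec m + (2 * (L : ℤ)) • unitVec p 0 + u) j) (m j)
  else 0

/-- The fundamental fermionic form `f^p_k(L; u; A)`, a sum over `m ∈ ℤ^{p-1}` (with `q = t ^ 4`). -/
noncomputable def fermionicForm (t : K) (p : ℕ) (k : ℤ) (L : ℕ) (u A : Fin (p - 1) → ℤ) : K :=
  ∑ᶠ m : Fin (p - 1) → ℤ, fermionicTerm t p k L u A m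

/-- Kronecker's delta. -/
def delta (a b : ℕ) : ℕ := if a = b then 1 else 0

/-- The parity `p̃(n)`: `1` for odd `n` and `0` for even `n`. -/
def parity (n : ℕ) : ℤ := if Odd n then 1 else 0

/-- The vector `θ(a > 1) e_a`. -/
def thetaVec (p a : ℕ) : Fin (p - 1) → ℤ := if 1 < a then unitVec p a else 0

/-- The vector `u^i_{a,b}`. -/
def uVec (p i a b : ℕ) : Fin (p - 1) → ℤ :=
  thetaVec p a + thetaVec p b +
    parity (a + delta a 1 + b + delta b 1 + delta i 1 * (p - 1)) • (unitVec p 1 - unitVec p 0)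

/-- The vector `A^i_{a,b}`. -/
def aVec (p i a b : ℕ) : Fin (p - 1) → ℤ :=
  thetaVec p b +
    parity (a + delta a 1 + b + delta b 1 + delta i 1 * (p - 1)) • unitVec p 1

/-- The index `k` of the fundamental fermionic form in `F^{p,i}_{a,b}`: `i` if `b ≠ p - 1`, and
`1 - i` if `b = p - 1`. -/
def fIndex (p i b : ℕ) : ℤ := if b = p - 1 then 1 - (i : ℤ) else (i : ℤ)

/-- The fermionic polynomial `F^{p,i}_{a,b}(L)` (with `q = t ^ 4`). -/
noncomputable def fermionicF (t : K) (p i a b L : ℕ) : K :=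
  fermionicForm t p (fIndex p i b) L (uVec p i a b) (aVec p i a b)

/-- The summand of the bosonic polynomial `B^p_{a,b}(L, s)`. -/
noncomputable def bosonicTerm (q : K) (p : ℕ) (a b : ℤ) (L : ℕ) (s j : ℤ) : K :=
  q ^ ((p : ℤ) * (p + 1) * j ^ 2 + j * ((p + 1) * a - p * s)) *
      qTrinomial q 0 L (2 * p * j + a - b) -
    q ^ ((p * j + a) * ((p + 1) * j + s)) * qTrinomial q 0 L (2 * p * j + a + b)

/-- The bosonic polynomial `B^p_{a,b}(L, s)`. -/
noncomputable def bosonicB (q : K) (p : ℕ) (a b : ℤ) (L : ℕ) (s : ℤ) : K :=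
  ∑ᶠ j : ℤ, bosonicTerm q p a b L s j

/-- The summand of the bosonic polynomial `B̃^p_{a,b}(L, s)`. -/
noncomputable def bosonicTildeTerm (q : K) (p : ℕ) (a b : ℤ) (L : ℕ) (s j : ℤ) : K :=
  q ^ ((p : ℤ) * (p + 1) * j ^ 2 + j * ((p + 1) * a - p * s)) *
      qTrinomial q 1 L (2 * p * j + a - b) -
    q ^ ((p : ℤ) * (p + 1) * j ^ 2 + j * ((p + 1) * a + p * (s - 2)) + a * (s - 1) - b) *
      qTrinomial q 1 L (2 * p * j + a + b)

/-- The bosonic polynomial `B̃^p_{a,b}(L, s)`. -/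
noncomputable def bosonicBTilde (q : K) (p : ℕ) (a b : ℤ) (L : ℕ) (s : ℤ) : K :=
  ∑ᶠ j : ℤ, bosonicTildeTerm q p a b L s j

theorem qTrinomial_eq_zero_of_large (q : K) (n : ℤ) {p : ℕ} (hp : 0 < p) (a b : ℤ) (L : ℕ) {j : ℤ}
    (hj : (L : ℤ) + |a| + |b| < |j|) :
    qTrinomial q n L (2 * p * j + a - b) = 0 ∧ qTrinomial q n L (2 * p * j + a + b) = 0 := by
  have h1 : |j| ≤ |2 * (p : ℤ) * j| := by
    rw [abs_mul]
    refine le_mul_of_one_le_left (abs_nonneg _) ?_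
    rw [abs_of_nonneg (by positivity)]
    omega
  generalize 2 * (p : ℤ) * j = x at h1 ⊢
  constructor <;> · rw [qTrinomial, if_neg]; grind

/-- The sum over `j` in `B^p_{a,b}(L, s)` has finitely many nonzero terms. -/
theorem bosonicTerm_finite (q : K) {p : ℕ} (hp : 0 < p) (a b : ℤ) (L : ℕ) (s : ℤ) :
    (Function.support (bosonicTerm q p a b L s)).Finite := by
  refine (Set.finite_Icc (-((L : ℤ) + |a| + |b|)) ((L : ℤ) + |a| + |b|)).subset fun j hj => ?_
  by_contra h
  obtain ⟨h1, h2⟩ := qTrinomial_eq_zero_of_large q 0 hp a b L (j := j)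
    (by rw [Set.mem_Icc, ← abs_le] at h; exact not_le.1 h)
  exact hj (by simp only [bosonicTerm, h1, h2, mul_zero, sub_zero])

/-- The sum over `j` in `B̃^p_{a,b}(L, s)` has finitely many nonzero terms. -/
theorem bosonicTildeTerm_finite (q : K) {p : ℕ} (hp : 0 < p) (a b : ℤ) (L : ℕ) (s : ℤ) :
    (Function.support (bosonicTildeTerm q p a b L s)).Finite := by
  refine (Set.finite_Icc (-((L : ℤ) + |a| + |b|)) ((L : ℤ) + |a| + |b|)).subset fun j hj => ?_
  by_contra h
  obtain ⟨h1, h2⟩ := qTrinomial_eq_zero_of_large q 1 hp a b L (j := j)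
    (by rw [Set.mem_Icc, ← abs_le] at h; exact not_le.1 h)
  exact hj (by simp only [bosonicTildeTerm, h1, h2, mul_zero, sub_zero])

/-- `4 φ(a, b)`, where `φ(a, b) = (b - a)(b - a + 1) / 4`. -/
def phi4 (a b : ℤ) : ℤ := (b - a) * (b - a + 1)

/-- `4 φ̃(a, b)`, where `φ̃(a, b) = (b - a)(b - a + 3) / 4`. -/
def phiTilde4 (a b : ℤ) : ℤ := (b - a) * (b - a + 3)

end PhiTwoOne

namespace PhiTwoOne

variable {K : Type*} [Field K]

/-! ### `q`-binomial coefficients -/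

/-! Put `N = p - 3` and shift the heights `a`, `b` down by one. The components `m₀`, `m₁` of a
summation vector couple to the other components `x₁, …, x_N` only through `M = m₀ + m₁` and `x₁`.
For fixed `M` and `x` the sum over `m₀` is a `q`-Vandermonde sum with value `[L; M]`
(`finsum_fermionicTerm_consEquiv`). This needs an even upper entry `2 n` for `m₁` with `n ≤ L`,
which the surviving summands have (`chainTerm_first_bound`). So `fermionicF` becomes a sum over `M`
of `t ^ (2 M² - …) [L; M]` times a fermionic sum on a chain of `N` sites with source `M` at site 1
and unit source at site `b` (`fermionicF_eq_sum_chainSum`).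

The core is `chainSum_eq_bosonicW`: `t ^ (M²)` times the chain sum is a power of `t` times
`bosonicW`, a difference of two towers of centred `q`-binomials `[M; (M - A) / 2]`. Both sides obey
the same recurrence in `M`, coupling `b` to `b ± 1`. On the bosonic side it holds termwise
(`centredBinomial_rec`). On the fermionic side it comes from applying Pascal's rule site after site,
so that a dipole travels along the chain (`chainSource_forward`, `chainSource_backward`); the travel
in the two directions leaves the same intermediate terms, which are then eliminated
(`chainSum_source_rec`). The left boundary is matched by `bosonicW_one`. At the right boundary, `b =
N + 1` is `b = 0` with the opposite parity of `x_N`, mirrored by `bosonicW_top` with `a` replaced by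
`p - a`; hence both parities are treated together. At `M = 0` both sides are Kronecker deltas,
because all inequalities on a nonzero fermionic summand are saturated
(`saturated_of_chainTerm_ne_zero`).

One factor `t ^ (M²)` is used up there. The other one, together with `[L; M]`, turns each centred
`q`-binomial into a `q`-trinomial (`sum_qBinomial_mul_centredBinomial`), and comparing exponents
gives the bosonic polynomials. -/

theorem qPoch_zero (a q : K) : qPoch a q 0 = 1 := by simp [qPoch]

theorem qPoch_self_succ (q : K) (n : ℕ) : qPoch q q (n + 1) = qPoch q q n * (1 - q ^ (n + 1)) := by
  rw [qPoch, Finset.prod_range_succ, ← qPoch, pow_succ']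

theorem qPoch_self_ne_zero {q : K} (hq : ∀ n : ℕ, 0 < n → q ^ n ≠ 1) (n : ℕ) :
    qPoch q q n ≠ 0 := by
  induction n with
  | zero => simp [qPoch_zero]
  | succ n ih =>
    rw [qPoch_self_succ]
    exact mul_ne_zero ih (sub_ne_zero.2 (hq _ n.succ_pos).symm)

theorem qBinomial_of_neg (q : K) {N m : ℤ} (h : m < 0) : qBinomial q N m = 0 := by
  rw [qBinomial, if_neg (by omega)]

theorem qBinomial_of_lt (q : K) {N m : ℤ} (h : N < m) : qBinomial q N m = 0 := by
  rw [qBinomial, if_neg (by omega)]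

theorem qBinomial_add_left (q : K) (k l : ℕ) :
    qBinomial q ((k : ℤ) + l) k = qPoch q q (k + l) / (qPoch q q k * qPoch q q l) := by
  rw [qBinomial, if_pos (by omega)]
  congr; omega

theorem qBinomial_symm (q : K) (N m : ℤ) : qBinomial q N (N - m) = qBinomial q N m := by
  unfold qBinomial
  simp only [sub_sub_cancel]
  simp only [and_comm, mul_comm]

theorem qBinomial_zero_right {q : K} (hq : ∀ n : ℕ, 0 < n → q ^ n ≠ 1) {N : ℤ} (h : 0 ≤ N) : qBinomial q N 0 = 1 := by
  obtain ⟨n, rfl⟩ := Int.eq_ofNat_of_zero_le h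
  have := qBinomial_add_left q 0 n
  simp only [Nat.cast_zero, zero_add, qPoch_zero, one_mul] at this
  rw [this, div_self (qPoch_self_ne_zero hq n)]

theorem qBinomial_self {q : K} (hq : ∀ n : ℕ, 0 < n → q ^ n ≠ 1) {N : ℤ} (h : 0 ≤ N) : qBinomial q N N = 1 := by
  rw [← qBinomial_symm, sub_self, qBinomial_zero_right hq h]

/-- The point `N = m = 0` must be excluded: there the left side is 1, while both terms on the right
have upper entry `-1` and vanish by convention. Every later use has to rule this point out. -/
theorem qBinomial_pascal {q : K} (hq : ∀ n : ℕ, 0 < n → q ^ n ≠ 1) {N m : ℤ}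
    (h : N ≠ 0 ∨ m ≠ 0) :
    qBinomial q N m = q ^ m * qBinomial q (N - 1) m + qBinomial q (N - 1) (m - 1) := by
  rcases lt_trichotomy m 0 with hm | rfl | hm
  · simp [qBinomial_of_neg q hm, qBinomial_of_neg q (show m - 1 < 0 by omega)]
  · rcases lt_or_ge N 0 with hN | hN
    · simp [qBinomial_of_lt q hN, qBinomial_of_lt q (show N - 1 < 0 by omega),
        qBinomial_of_neg q (show (-1 : ℤ) < 0 by omega)]
    · rw [qBinomial_zero_right hq hN, qBinomial_zero_right hq (by omega),
        qBinomial_of_neg q (by omega)]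
      simp
  · rcases lt_trichotomy N m with hN | rfl | hN
    · simp [qBinomial_of_lt q hN, qBinomial_of_lt q (show N - 1 < m by omega),
        qBinomial_of_lt q (show N - 1 < m - 1 by omega)]
    · rw [qBinomial_self hq (by omega), qBinomial_self hq (by omega),
        qBinomial_of_lt q (by omega)]
      simp
    · obtain ⟨k, rfl⟩ : ∃ k : ℕ, m = k + 1 := ⟨(m - 1).toNat, by omega⟩
      obtain ⟨l, rfl⟩ : ∃ l : ℕ, N = k + l + 2 := ⟨(N - k - 2).toNat, by omega⟩
      have h1 := qBinomial_add_left q (k + 1) (l + 1)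
      have h2 := qBinomial_add_left q (k + 1) l
      have h3 := qBinomial_add_left q k (l + 1)
      push_cast at h1 h2 h3
      rw [show (k : ℤ) + l + 2 = k + 1 + (l + 1) by ring, h1,
        show (k : ℤ) + 1 + (l + 1) - 1 = k + 1 + l by ring, h2,
        show (k : ℤ) + 1 + l = k + (l + 1) by ring, show (k : ℤ) + 1 - 1 = k by ring, h3,
        show k + 1 + (l + 1) = k + l + 1 + 1 by ring, show k + (l + 1) = k + l + 1 by ring,
        show k + 1 + l = k + l + 1 by ring, qPoch_self_succ q (k + l + 1), qPoch_self_succ q k,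
        qPoch_self_succ q l]
      have e1 := qPoch_self_ne_zero hq k
      have e2 := qPoch_self_ne_zero hq l
      have e3 : 1 - q ^ (k + 1) ≠ 0 := sub_ne_zero.2 (hq _ k.succ_pos).symm
      have e4 : 1 - q ^ (l + 1) ≠ 0 := sub_ne_zero.2 (hq _ l.succ_pos).symm
      have e5 : q ^ ((k : ℤ) + 1) = q ^ (k + 1) := by norm_cast
      rw [e5]
      field_simp
      ring

theorem qBinomial_pascal' {q : K} (hq : ∀ n : ℕ, 0 < n → q ^ n ≠ 1) {N m : ℤ}
    (h : N ≠ 0 ∨ m ≠ 0) :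
    qBinomial q N m = qBinomial q (N - 1) m + q ^ (N - m) * qBinomial q (N - 1) (m - 1) := by
  rw [← qBinomial_symm q N m, qBinomial_pascal hq (by omega), ← qBinomial_symm q (N - 1) m,
    ← qBinomial_symm q (N - 1) (m - 1)]
  rw [show N - 1 - m = N - m - 1 by ring, show N - 1 - (m - 1) = N - m by ring]
  ring

theorem qBinomial_absorb {q : K} (hq : ∀ n : ℕ, 0 < n → q ^ n ≠ 1) {N : ℤ} (h : 0 ≤ N) (m : ℤ) :
    (1 - q ^ m) * qBinomial q N m = (1 - q ^ N) * qBinomial q (N - 1) (m - 1) := by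
  rcases le_or_gt m 0 with hm | hm
  · rw [qBinomial_of_neg q (show m - 1 < 0 by omega)]
    rcases hm.lt_or_eq with hm | rfl
    · simp [qBinomial_of_neg q hm]
    · simp
  · rcases lt_or_ge N m with hN | hN
    · simp [qBinomial_of_lt q hN, qBinomial_of_lt q (show N - 1 < m - 1 by omega)]
    · obtain ⟨k, rfl⟩ : ∃ k : ℕ, m = k + 1 := ⟨(m - 1).toNat, by omega⟩
      obtain ⟨l, rfl⟩ : ∃ l : ℕ, N = k + 1 + l := ⟨(N - k - 1).toNat, by omega⟩
      have h1 := qBinomial_add_left q (k + 1) l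
      have h3 := qBinomial_add_left q k l
      push_cast at h1 h3
      rw [h1, show (k : ℤ) + 1 + l - 1 = k + l by ring, show (k : ℤ) + 1 - 1 = k by ring, h3,
        show k + 1 + l = k + l + 1 by ring, qPoch_self_succ, qPoch_self_succ]
      have e1 := qPoch_self_ne_zero hq k
      have e2 := qPoch_self_ne_zero hq l
      have e3 : 1 - q ^ (k + 1) ≠ 0 := sub_ne_zero.2 (hq _ k.succ_pos).symm
      have e5 : q ^ ((k : ℤ) + 1) = q ^ (k + 1) := by norm_cast
      have e6 : q ^ ((k : ℤ) + 1 + l) = q ^ (k + l + 1) := by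
        rw [← zpow_natCast]; congr 1; push_cast; ring
      rw [e5, e6]
      field_simp

theorem qBinomial_succ_right {q : K} (hq : ∀ n : ℕ, 0 < n → q ^ n ≠ 1) {N : ℤ} (h : 0 ≤ N) (m : ℤ) :
    (1 - q ^ (m + 1)) * qBinomial q N (m + 1) = (1 - q ^ (N - m)) * qBinomial q N m := by
  rw [qBinomial_absorb hq h, ← qBinomial_symm q N m, qBinomial_absorb hq h,
    ← qBinomial_symm q (N - 1)]
  congr 2
  ring

/-- The `q`-Vandermonde sum. -/
theorem qBinomial_vandermonde {q : K} (hq : ∀ n : ℕ, 0 < n → q ^ n ≠ 1) (hq0 : q ≠ 0)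
    (l n : ℕ) (M : ℤ) :
    ∑ i ∈ Finset.range (l + 1), q ^ ((i : ℤ) * (n - (M - i))) * qBinomial q l i *
      qBinomial q n (M - i) = qBinomial q (l + n) M := by
  induction n generalizing M with
  | zero =>
    simp only [Nat.cast_zero, add_zero]
    have h0 : ∀ i : ℕ, (i : ℤ) ≠ M → q ^ ((i : ℤ) * (0 - (M - i))) * qBinomial q l i *
        qBinomial q 0 (M - i) = 0 := fun i hi => by
      rcases lt_or_gt_of_ne (sub_ne_zero.2 hi.symm) with h | h
      · rw [qBinomial_of_neg q h, mul_zero]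
      · rw [qBinomial_of_lt q h, mul_zero]
    by_cases hM : 0 ≤ M ∧ M ≤ l
    · rw [Finset.sum_eq_single M.toNat (fun i _ hi => h0 i (by omega))
        (fun hi => absurd (Finset.mem_range.2 (by omega)) hi)]
      rw [Int.toNat_of_nonneg hM.1]
      simp [qBinomial_zero_right hq le_rfl]
    · rw [Finset.sum_eq_zero fun i hi => h0 i (by rw [Finset.mem_range] at hi; omega)]
      rcases lt_or_ge M 0 with h | h
      · rw [qBinomial_of_neg q h]
      · rw [qBinomial_of_lt q (by omega)]
  | succ n ih =>
    push_cast
    -- Pascal's rule is applied to the right side and, below, to the second factor of each summand;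
    -- the two match term by term for `M` and `M - 1`.
    rw [qBinomial_pascal hq (Or.inl (by omega)), show (l : ℤ) + (n + 1) - 1 = l + n by ring,
      ← ih, ← ih, Finset.mul_sum, ← Finset.sum_add_distrib]
    refine Finset.sum_congr rfl fun i _ => ?_
    rw [qBinomial_pascal hq (N := (n : ℤ) + 1) (Or.inl (by omega)),
      show (n : ℤ) + 1 - 1 = n by ring, show M - i - 1 = M - 1 - i by ring]
    have e1 : q ^ ((i : ℤ) * (n + 1 - (M - i))) * q ^ (M - i) =
        q ^ M * q ^ ((i : ℤ) * (n - (M - i))) := by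
      rw [← zpow_add₀ hq0, ← zpow_add₀ hq0]; congr 1; ring
    have e2 : q ^ ((i : ℤ) * (n + 1 - (M - i))) = q ^ ((i : ℤ) * (n - (M - 1 - i))) := by
      congr 1; ring
    linear_combination qBinomial q l i * qBinomial q n (M - i) * e1 +
      qBinomial q l i * qBinomial q n (M - 1 - i) * e2

/-! ### Centred `q`-binomials and `q`-trinomials -/

/-- The centred `q`-binomial coefficient `[M; (M - A) / 2]` with `q = t ^ 4`; it vanishes if
`M - A` is odd. -/
noncomputable def centredBinomial (t : K) (M A : ℤ) : K :=
  if Even (M - A) then qBinomial (t ^ 4) M ((M - A) / 2) else 0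

theorem pow_four_ne_one {t : K} (ht : ∀ n : ℕ, 0 < n → t ^ n ≠ 1) :
    ∀ n : ℕ, 0 < n → (t ^ 4) ^ n ≠ 1 := fun n hn => by
  rw [← pow_mul]
  exact ht _ (by omega)

theorem pow_four_zpow (t : K) (n : ℤ) : (t ^ 4) ^ n = t ^ (4 * n) := by
  rw [zpow_mul]; norm_cast

theorem centredBinomial_of_odd (t : K) {M A : ℤ} (h : Odd (M - A)) : centredBinomial t M A = 0 := by
  rw [centredBinomial, if_neg (Int.not_even_iff_odd.2 h)]

theorem centredBinomial_of_eq (t : K) {M A k : ℤ} (h : M - A = k + k) :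
    centredBinomial t M A = qBinomial (t ^ 4) M k := by
  rw [centredBinomial, if_pos ⟨k, h⟩, show (M - A) / 2 = k by omega]

theorem centredBinomial_of_lt (t : K) {M A : ℤ} (h : M < |A|) : centredBinomial t M A = 0 := by
  rcases Int.even_or_odd (M - A) with ⟨k, hk⟩ | h'
  · rw [centredBinomial_of_eq t hk]
    rcases le_or_gt 0 A with hA | hA
    · rw [abs_of_nonneg hA] at h
      exact qBinomial_of_neg _ (by omega)
    · rw [abs_of_neg hA] at h
      exact qBinomial_of_lt _ (by omega)
  · exact centredBinomial_of_odd t h'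

theorem centredBinomial_neg (t : K) (M A : ℤ) : centredBinomial t M (-A) = centredBinomial t M A := by
  rcases Int.even_or_odd (M - A) with ⟨k, hk⟩ | ⟨k, hk⟩
  · rw [centredBinomial_of_eq t hk, centredBinomial_of_eq t (k := M - k) (by omega),
      qBinomial_symm]
  · rw [centredBinomial_of_odd t ⟨k, hk⟩, centredBinomial_of_odd t ⟨M - k - 1, by omega⟩]

theorem centredBinomial_zero {t : K} (ht : ∀ n : ℕ, 0 < n → t ^ n ≠ 1) (A : ℤ) :
    centredBinomial t 0 A = if A = 0 then 1 else 0 := by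
  split_ifs with h
  · rw [h, centredBinomial_of_eq t (k := 0) (by omega),
      qBinomial_zero_right (pow_four_ne_one ht) le_rfl]
  · exact centredBinomial_of_lt t (abs_pos.2 h)

theorem centredBinomial_succ {t : K} (ht : ∀ n : ℕ, 0 < n → t ^ n ≠ 1) {M : ℤ} (hM : 0 ≤ M)
    (A : ℤ) : centredBinomial t (M + 1) A =
      centredBinomial t M (A - 1) + t ^ (2 * (M + 1 + A)) * centredBinomial t M (A + 1) := by
  rcases Int.even_or_odd (M + 1 - A) with ⟨k, hk⟩ | ⟨k, hk⟩
  · rw [centredBinomial_of_eq t hk, centredBinomial_of_eq t (k := k) (by omega),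
      centredBinomial_of_eq t (k := k - 1) (by omega),
      qBinomial_pascal' (pow_four_ne_one ht) (Or.inl (by omega)), pow_four_zpow,
      show 4 * (M + 1 - k) = 2 * (M + 1 + A) by omega, add_sub_cancel_right]
  · rw [centredBinomial_of_odd t ⟨k, hk⟩, centredBinomial_of_odd t ⟨k, by omega⟩,
      centredBinomial_of_odd t ⟨k - 1, by omega⟩]
    simp

theorem centredBinomial_succ' {t : K} (ht : ∀ n : ℕ, 0 < n → t ^ n ≠ 1) {M : ℤ} (hM : 0 ≤ M)
    (A : ℤ) : centredBinomial t (M + 1) A =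
      centredBinomial t M (A + 1) + t ^ (2 * (M + 1 - A)) * centredBinomial t M (A - 1) := by
  have := centredBinomial_succ ht hM (-A)
  rw [centredBinomial_neg, ← neg_add', centredBinomial_neg,
    show -A + 1 = -(A - 1) by ring, centredBinomial_neg] at this
  exact this

/-- Pascal's rule has a coefficient depending on `A`; the absorption identity trades it for a term
at `M - 1`. The remaining coefficient depends on `M` alone, so the relation survives summation over
`A` with arbitrary weights. -/
theorem centredBinomial_rec {t : K} (ht : ∀ n : ℕ, 0 < n → t ^ n ≠ 1) {M : ℤ} (hM : 0 ≤ M)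
    (A : ℤ) : centredBinomial t (M + 1) A = centredBinomial t M (A + 1) +
      centredBinomial t M (A - 1) + (t ^ (4 * M) - 1) * centredBinomial t (M - 1) A := by
  rcases Int.even_or_odd (M + 1 - A) with ⟨k, hk⟩ | ⟨k, hk⟩
  · rw [centredBinomial_of_eq t hk, centredBinomial_of_eq t (k := k - 1) (by omega),
      centredBinomial_of_eq t (M := M) (k := k) (by omega),
      centredBinomial_of_eq t (M := M - 1) (k := k - 1) (by omega),
      qBinomial_pascal (pow_four_ne_one ht) (Or.inl (by omega)), add_sub_cancel_right,
      ← pow_four_zpow]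
    linear_combination -(qBinomial_absorb (pow_four_ne_one ht) hM k)
  · rw [centredBinomial_of_odd t ⟨k, hk⟩, centredBinomial_of_odd t ⟨k - 1, by omega⟩,
      centredBinomial_of_odd t ⟨k, by omega⟩, centredBinomial_of_odd t ⟨k - 1, by omega⟩]
    simp

/-- This is the ratio of neighbouring binomials, equivalently the equality of the two Pascal rules.
It changes the powers of `t` in front of a pair of towers centred at `A ± 1`. -/
theorem centredBinomial_sub {t : K} (ht : ∀ n : ℕ, 0 < n → t ^ n ≠ 1) {M : ℤ} (hM : 0 ≤ M)
    (A : ℤ) : centredBinomial t M (A + 1) - centredBinomial t M (A - 1) =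
      t ^ (2 * (M + A + 1)) * centredBinomial t M (A + 1) -
        t ^ (2 * (M - A + 1)) * centredBinomial t M (A - 1) := by
  rcases Int.even_or_odd (M - (A + 1)) with ⟨k, hk⟩ | ⟨k, hk⟩
  · rw [centredBinomial_of_eq t hk, centredBinomial_of_eq t (k := k + 1) (by omega),
      show 2 * (M + A + 1) = 4 * (M - k) by omega, show 2 * (M - A + 1) = 4 * (k + 1) by omega,
      ← pow_four_zpow, ← pow_four_zpow]
    linear_combination -(qBinomial_succ_right (pow_four_ne_one ht) hM k)
  · rw [centredBinomial_of_odd t ⟨k, hk⟩, centredBinomial_of_odd t ⟨k + 1, by omega⟩]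
    simp

theorem qPochRecip_natCast (a q : K) (k : ℕ) : qPochRecip a q k = (qPoch a q k)⁻¹ := by
  rw [qPochRecip, if_pos (by omega), Int.toNat_natCast]

/-- The connection formula between `q`-trinomials and `q`-binomials. -/
theorem sum_qBinomial_mul_centredBinomial {t : K} (ht0 : t ≠ 0) (ht : ∀ n : ℕ, 0 < n → t ^ n ≠ 1)
    (n : ℤ) (L : ℕ) (A : ℤ) :
    ∑ M ∈ Finset.range (L + 1),
      t ^ ((M : ℤ) ^ 2 - 2 * n * M) * qBinomial (t ^ 4) L M * centredBinomial t M A =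
    t ^ (A ^ 2 - 2 * n * A) * qTrinomial (t ^ 4) n L A := by
  have hq := pow_four_ne_one ht
  rw [qTrinomial]
  split_ifs with hA
  · rw [Finset.mul_sum]
    symm
    have hneg : ∀ k : ℤ, qPochRecip (t ^ 4) (t ^ 4) k ≠ 0 → 0 ≤ k := fun k hk => by
      by_contra h
      exact hk (qPochRecip_of_neg (pow_ne_zero 4 ht0) (by omega))
    -- The index `j` corresponds to `M = 2 j + A`, which is nonnegative on nonzero terms since `j`
    -- and `j + A` are.
    refine Finset.sum_bij_ne_zero (fun j _ _ => (2 * j + A).toNat) ?_ ?_ ?_ ?_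
    · intro j _ h
      have := hneg _ (right_ne_zero_of_mul (right_ne_zero_of_mul h))
      rw [Finset.mem_range]; omega
    · intro j _ h j' _ h' e
      have := hneg _ (right_ne_zero_of_mul (left_ne_zero_of_mul (right_ne_zero_of_mul h)))
      have := hneg _ (right_ne_zero_of_mul (left_ne_zero_of_mul (right_ne_zero_of_mul h')))
      omega
    · intro M hM h
      rw [Finset.mem_range] at hM
      have h1 : ¬ Odd ((M : ℤ) - A) := fun h' => h (by rw [centredBinomial_of_odd t h', mul_zero])
      obtain ⟨k, hk⟩ := Int.not_odd_iff_even.1 h1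
      rw [centredBinomial_of_eq t hk] at h
      have h2 : 0 ≤ k := by
        by_contra h'
        exact h (by rw [qBinomial_of_neg (m := k) _ (by omega), mul_zero])
      have h3 : k ≤ M := by
        by_contra h'
        exact h (by rw [qBinomial_of_lt (N := M) (m := k) _ (by omega), mul_zero])
      obtain ⟨j, rfl⟩ := Int.eq_ofNat_of_zero_le h2
      refine ⟨j, Finset.mem_range.2 (by omega), ?_, by omega⟩
      refine mul_ne_zero (zpow_ne_zero _ ht0) (mul_ne_zero (mul_ne_zero (mul_ne_zero (mul_ne_zero
        (zpow_ne_zero _ (pow_ne_zero 4 ht0)) (qPoch_self_ne_zero hq _))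
        (inv_ne_zero (qPoch_self_ne_zero hq _))) ?_) ?_)
      · rw [show (j : ℤ) + A = ((M - j : ℕ) : ℤ) by omega, qPochRecip_natCast]
        exact inv_ne_zero (qPoch_self_ne_zero hq _)
      · rw [show (L : ℤ) - 2 * j - A = ((L - M : ℕ) : ℤ) by omega, qPochRecip_natCast]
        exact inv_ne_zero (qPoch_self_ne_zero hq _)
    · intro j _ h
      have h1 := hneg _ (right_ne_zero_of_mul (right_ne_zero_of_mul h))
      have h2 := hneg _ (right_ne_zero_of_mul (left_ne_zero_of_mul (right_ne_zero_of_mul h)))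
      obtain ⟨k, hk⟩ := Int.eq_ofNat_of_zero_le h2
      obtain ⟨r, hr⟩ := Int.eq_ofNat_of_zero_le h1
      rw [hk, hr, qPochRecip_natCast, qPochRecip_natCast,
        show (2 * (j : ℤ) + A).toNat = j + k by omega,
        centredBinomial_of_eq t (k := j) (by push_cast; omega)]
      have e1 := qBinomial_add_left (t ^ 4) (j + k) r
      have e2 := qBinomial_add_left (t ^ 4) j k
      rw [show (L : ℤ) = ((j + k : ℕ) : ℤ) + r by push_cast; omega, e1, Nat.cast_add, e2,
        show L = j + k + r by omega, pow_four_zpow]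
      have d1 := qPoch_self_ne_zero hq j
      have d2 := qPoch_self_ne_zero hq k
      have d3 := qPoch_self_ne_zero hq r
      have d4 := qPoch_self_ne_zero hq (j + k)
      -- With `M = j + k` and `A = k - j` one has `M² - A² = 4 j k` and `M - A = 2 j`.
      have e : t ^ (A ^ 2 - 2 * n * A) * t ^ (4 * ((j : ℤ) * (k - n))) =
          t ^ (((j : ℤ) + k) ^ 2 - 2 * n * (j + k)) := by
        rw [← zpow_add₀ ht0, show A = k - j by omega]; congr 1; ring
      rw [← e]
      field_simp
  · rw [mul_zero]
    refine Finset.sum_eq_zero fun M hM => ?_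
    rw [Finset.mem_range] at hM
    rw [centredBinomial_of_lt t (by omega), mul_zero]

/-! ### Bosonic sums -/

/-- The bosonic sum with two towers of centred `q`-binomials. -/
noncomputable def bosonicW (t : K) (p a M b : ℤ) : K :=
  ∑ᶠ j : ℤ, (t ^ (4 * (j * (p * j - p + a))) * centredBinomial t M (2 * p * j + a - b) -
    t ^ (4 * ((j + 1) * (p * j + a))) * centredBinomial t M (2 * p * j + a + b))

theorem finite_abs_two_mul_add_le {p : ℤ} (hp : 0 < p) (c M : ℤ) :
    {j : ℤ | |2 * p * j + c| ≤ M}.Finite := by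
  refine (Set.finite_Icc (-(M + |c|)) (M + |c|)).subset fun j hj => ?_
  rw [Set.mem_Icc, ← abs_le]
  have h1 : |j| ≤ |2 * p * j| := by
    rw [abs_mul]
    refine le_mul_of_one_le_left (abs_nonneg _) ?_
    rw [abs_of_nonneg (by positivity)]
    omega
  have h2 : |2 * p * j| ≤ |2 * p * j + c| + |c| := by
    simpa using abs_sub (2 * p * j + c) c
  have h3 : |2 * p * j + c| ≤ M := hj
  omega

theorem hasFiniteSupport_tower {p : ℤ} (hp : 0 < p) (t : K) (f : ℤ → K) (M c : ℤ) :
    Function.HasFiniteSupport fun j : ℤ => f j * centredBinomial t M (2 * p * j + c) := by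
  refine (finite_abs_two_mul_add_le hp c M).subset fun j hj => ?_
  by_contra h
  exact hj (by simp only [centredBinomial_of_lt t (not_le.1 h), mul_zero])

theorem bosonicW_eq {p : ℤ} (hp : 0 < p) (t : K) (a M b : ℤ) : bosonicW t p a M b =
    ∑ᶠ j : ℤ, t ^ (4 * (j * (p * j - p + a))) * centredBinomial t M (2 * p * j + (a - b)) -
    ∑ᶠ j : ℤ, t ^ (4 * ((j + 1) * (p * j + a))) * centredBinomial t M (2 * p * j + (a + b)) := by
  rw [← finsum_sub_distrib (hasFiniteSupport_tower hp t _ _ _) (hasFiniteSupport_tower hp t _ _ _)]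
  simp only [bosonicW, add_sub_assoc, add_assoc]

/-- The weights `f` are arbitrary because the coefficients in `centredBinomial_rec` do not involve
`A`. -/
theorem tower_rec {p : ℤ} (hp : 0 < p) {t : K} (ht : ∀ n : ℕ, 0 < n → t ^ n ≠ 1) (f : ℤ → K)
    {M : ℤ} (hM : 0 ≤ M) (c : ℤ) :
    ∑ᶠ j : ℤ, f j * centredBinomial t (M + 1) (2 * p * j + c) =
      ∑ᶠ j : ℤ, f j * centredBinomial t M (2 * p * j + (c + 1)) +
      ∑ᶠ j : ℤ, f j * centredBinomial t M (2 * p * j + (c - 1)) +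
      (t ^ (4 * M) - 1) * ∑ᶠ j : ℤ, f j * centredBinomial t (M - 1) (2 * p * j + c) := by
  rw [mul_finsum, ← finsum_add_distrib (hasFiniteSupport_tower hp t _ _ _)
    (hasFiniteSupport_tower hp t _ _ _), ← finsum_add_distrib]
  · refine finsum_congr fun j => ?_
    rw [centredBinomial_rec ht hM, add_assoc (2 * p * j) c 1, add_sub_assoc (2 * p * j) c 1]
    ring
  · exact (hasFiniteSupport_tower hp t f M (c + 1)).add (hasFiniteSupport_tower hp t f M (c - 1))
  · simp only [← mul_assoc]
    exact hasFiniteSupport_tower hp t (fun j => (t ^ (4 * M) - 1) * f j) (M - 1) c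

theorem bosonicW_rec {p : ℤ} (hp : 0 < p) {t : K} (ht : ∀ n : ℕ, 0 < n → t ^ n ≠ 1)
    (a : ℤ) {M : ℤ} (hM : 0 ≤ M) (b : ℤ) : bosonicW t p a (M + 1) b =
      bosonicW t p a M (b + 1) + bosonicW t p a M (b - 1) +
        (t ^ (4 * M) - 1) * bosonicW t p a (M - 1) b := by
  simp only [bosonicW_eq hp]
  rw [tower_rec hp ht _ hM, tower_rec hp ht _ hM, show a - b + 1 = a - (b - 1) by ring,
    show a - b - 1 = a - (b + 1) by ring, show a + b + 1 = a + (b + 1) by ring,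
    show a + b - 1 = a + (b - 1) by ring]
  ring

/-- The two towers are expanded by opposite Pascal rules. Each produces a term centred at `2 p j +
a`, with equal coefficients, and these cancel in the difference. -/
theorem bosonicW_one {t : K} (ht0 : t ≠ 0) (ht : ∀ n : ℕ, 0 < n → t ^ n ≠ 1)
    (p a : ℤ) {M : ℤ} (hM : 0 ≤ M) : bosonicW t p a (M + 1) 1 = bosonicW t p a M 2 := by
  refine finsum_congr fun j => ?_
  rw [centredBinomial_succ ht hM, centredBinomial_succ' ht hM,
    show 2 * p * j + a - 1 - 1 = 2 * p * j + a - 2 by ring,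
    show 2 * p * j + a + 1 + 1 = 2 * p * j + a + 2 by ring, sub_add_cancel, add_sub_cancel_right]
  have e : t ^ (4 * (j * (p * j - p + a))) * t ^ (2 * (M + 1 + (2 * p * j + a - 1))) =
      t ^ (4 * ((j + 1) * (p * j + a))) * t ^ (2 * (M + 1 - (2 * p * j + a + 1))) := by
    rw [← zpow_add₀ ht0, ← zpow_add₀ ht0]; congr 1; ring
  linear_combination centredBinomial t M (2 * p * j + a) * e

theorem bosonicW_zero {t : K} (ht : ∀ n : ℕ, 0 < n → t ^ n ≠ 1) {p a b : ℤ}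
    (ha : 0 < a) (hap : a < p) (hb : 0 < b) (hbp : b < p) :
    bosonicW t p a 0 b = if a = b then 1 else 0 := by
  -- At `M = 0` only a zero lower argument contributes; this is applied with `c = a + b`, and with
  -- `c = a - b` when `a ≠ b`.
  have h : ∀ c : ℤ, c ≠ 0 → |c| < 2 * p → ∀ j : ℤ, 2 * p * j + c ≠ 0 := fun c hc hcp j hj => by
    have h1 : 2 * p * |j| < 2 * p * 1 := by
      rw [mul_one, ← abs_of_pos (show 0 < 2 * p by omega), ← abs_mul, abs_mul (2 * p),
        ← abs_mul, show 2 * p * j = -c by omega, abs_neg, abs_of_pos (show 0 < 2 * p by omega)]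
      exact hcp
    have h2 := lt_of_mul_lt_mul_left h1 (by omega)
    have h3 : j = 0 := by rw [← Int.abs_lt_one_iff]; exact h2
    rw [h3] at hj
    omega
  have e : ∀ j : ℤ, t ^ (4 * (j * (p * j - p + a))) * centredBinomial t 0 (2 * p * j + a - b) -
      t ^ (4 * ((j + 1) * (p * j + a))) * centredBinomial t 0 (2 * p * j + a + b) =
      if j = 0 then (if a = b then 1 else 0) else 0 := fun j => by
    rw [centredBinomial_zero ht, centredBinomial_zero ht, add_assoc, if_neg (h (a + b) (by omega)
      (by rw [abs_of_pos (by omega)]; omega) j), mul_zero, sub_zero]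
    by_cases hab : a = b
    · subst hab
      by_cases hj : j = 0
      · simp [hj]
      · rw [if_neg, mul_zero, if_neg hj]
        intro h'
        have : 2 * p * j = 0 := by omega
        rcases mul_eq_zero.1 this with h'' | h'' <;> omega
    · rw [add_sub_assoc, if_neg (h (a - b) (by omega) (by rw [abs_lt]; omega) j)]
      simp [hab]
  simp only [bosonicW, e]
  rw [finsum_eq_single _ 0 fun j hj => if_neg hj, if_pos rfl]

theorem tower_shift (t : K) (p : ℤ) (f : ℤ → K) (M c : ℤ) :
    ∑ᶠ j : ℤ, f j * centredBinomial t M (2 * p * j + c) =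
      ∑ᶠ j : ℤ, f (j + 1) * centredBinomial t M (2 * p * j + (c + 2 * p)) := by
  rw [← finsum_comp_equiv (Equiv.addRight (1 : ℤ))]
  refine finsum_congr fun j => ?_
  rw [Equiv.coe_addRight]
  congr 2
  ring

theorem tower_reflect (t : K) (p : ℤ) (f : ℤ → K) (M c : ℤ) :
    ∑ᶠ j : ℤ, f j * centredBinomial t M (2 * p * j + c) =
      ∑ᶠ j : ℤ, f (-1 - j) * centredBinomial t M (2 * p * j + (2 * p - c)) := by
  rw [← finsum_comp_equiv (Equiv.subLeft (-1 : ℤ))]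
  refine finsum_congr fun j => ?_
  rw [Equiv.subLeft_apply, ← centredBinomial_neg]
  congr 2
  ring

/-- At `b = p - 1`, shifting the first tower by one period gives both towers the same weight and
puts them at distance one on either side of `2 p j + p + a`. Then `centredBinomial_sub` applies, and
the result is recognised on the other side after the reflection `j ↦ -1 - j`. -/
theorem bosonicW_top {p : ℤ} (hp : 0 < p) {t : K} (ht0 : t ≠ 0) (ht : ∀ n : ℕ, 0 < n → t ^ n ≠ 1)
    (a : ℤ) {M : ℤ} (hM : 0 ≤ M) :
    bosonicW t p a M (p - 1) = t ^ (2 * M - 2 * (p - a - 1)) * bosonicW t p (p - a) M 1 := by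
  rw [bosonicW_eq hp, bosonicW_eq hp, tower_shift, tower_reflect t p _ M (p - a - 1),
    tower_reflect t p _ M (p - a + 1),
    ← finsum_sub_distrib (hasFiniteSupport_tower hp t _ _ _) (hasFiniteSupport_tower hp t _ _ _),
    ← finsum_sub_distrib (hasFiniteSupport_tower hp t _ _ _) (hasFiniteSupport_tower hp t _ _ _),
    mul_finsum]
  refine finsum_congr fun j => ?_
  have h := centredBinomial_sub ht hM (2 * p * j + p + a)
  rw [show 2 * p * j + (2 * p - (p - a - 1)) = 2 * p * j + p + a + 1 by ring,
    show 2 * p * j + (2 * p - (p - a + 1)) = 2 * p * j + p + a - 1 by ring,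
    show 2 * p * j + (a - (p - 1) + 2 * p) = 2 * p * j + p + a + 1 by ring,
    show 2 * p * j + (a + (p - 1)) = 2 * p * j + p + a - 1 by ring,
    show (j + 1) * (p * (j + 1) - p + a) = (j + 1) * (p * j + a) by ring]
  have e1 : t ^ (4 * ((j + 1) * (p * j + a))) * t ^ (2 * (M + (2 * p * j + p + a) + 1)) =
      t ^ (2 * M - 2 * (p - a - 1)) *
        t ^ (4 * ((-1 - j) * (p * (-1 - j) - p + (p - a)))) := by
    simp only [← zpow_add₀ ht0]; congr 1; ring
  have e2 : t ^ (4 * ((j + 1) * (p * j + a))) * t ^ (2 * (M - (2 * p * j + p + a) + 1)) =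
      t ^ (2 * M - 2 * (p - a - 1)) *
        t ^ (4 * ((-1 - j + 1) * (p * (-1 - j) + (p - a)))) := by
    simp only [← zpow_add₀ ht0]; congr 1; ring
  linear_combination t ^ (4 * ((j + 1) * (p * j + a))) * h +
    centredBinomial t M (2 * p * j + p + a + 1) * e1 -
      centredBinomial t M (2 * p * j + p + a - 1) * e2

/-- The sum occurring on the bosonic side of the identities with `b = 1` and an integral shift. -/
theorem bosonicW_one_eq {t : K} (ht0 : t ≠ 0) (ht : ∀ n : ℕ, 0 < n → t ^ n ≠ 1)
    (p a : ℤ) {M : ℤ} (hM : 0 ≤ M) : t ^ (2 * M) * bosonicW t p a M 1 =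
      t ^ (2 * (a - 1)) * ∑ᶠ j : ℤ, (t ^ (4 * (j * (p * j + a))) *
        centredBinomial t M (2 * p * j + a - 1) -
          t ^ (4 * (j * (p * j + a))) * centredBinomial t M (2 * p * j + a + 1)) := by
  rw [bosonicW, mul_finsum, mul_finsum]
  refine finsum_congr fun j => ?_
  have h := centredBinomial_sub ht hM (2 * p * j + a)
  have e1 : t ^ (2 * (a - 1)) * t ^ (4 * (j * (p * j + a))) * t ^ (2 * (M + (2 * p * j + a) + 1)) =
      t ^ (2 * M) * t ^ (4 * ((j + 1) * (p * j + a))) := by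
    simp only [← zpow_add₀ ht0]; congr 1; ring
  have e2 : t ^ (2 * (a - 1)) * t ^ (4 * (j * (p * j + a))) * t ^ (2 * (M - (2 * p * j + a) + 1)) =
      t ^ (2 * M) * t ^ (4 * (j * (p * j - p + a))) := by
    simp only [← zpow_add₀ ht0]; congr 1; ring
  linear_combination t ^ (2 * (a - 1)) * t ^ (4 * (j * (p * j + a))) * h +
    centredBinomial t M (2 * p * j + a + 1) * e1 - centredBinomial t M (2 * p * j + a - 1) * e2

/-- Summation of towers of centred `q`-binomials to towers of `q`-trinomials. -/
theorem sum_qBinomial_mul_towers {t : K} (ht0 : t ≠ 0) (ht : ∀ n : ℕ, 0 < n → t ^ n ≠ 1)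
    {p : ℤ} (hp : 0 < p) (n : ℤ) (L : ℕ) (e₁ e₂ : ℤ → ℤ) (c₁ c₂ : ℤ) :
    ∑ M ∈ Finset.range (L + 1), t ^ ((M : ℤ) ^ 2 - 2 * n * M) * qBinomial (t ^ 4) L M *
      ∑ᶠ j : ℤ, (t ^ e₁ j * centredBinomial t M (2 * p * j + c₁) -
        t ^ e₂ j * centredBinomial t M (2 * p * j + c₂)) =
    ∑ᶠ j : ℤ, (t ^ (e₁ j + ((2 * p * j + c₁) ^ 2 - 2 * n * (2 * p * j + c₁))) *
        qTrinomial (t ^ 4) n L (2 * p * j + c₁) -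
      t ^ (e₂ j + ((2 * p * j + c₂) ^ 2 - 2 * n * (2 * p * j + c₂))) *
        qTrinomial (t ^ 4) n L (2 * p * j + c₂)) := by
  simp only [mul_finsum]
  rw [← finsum_sum_comm]
  · refine finsum_congr fun j => ?_
    rw [zpow_add₀ ht0, zpow_add₀ ht0, mul_assoc (t ^ e₁ j), mul_assoc (t ^ e₂ j),
      ← sum_qBinomial_mul_centredBinomial ht0 ht, ← sum_qBinomial_mul_centredBinomial ht0 ht,
      Finset.mul_sum, Finset.mul_sum, ← Finset.sum_sub_distrib]
    exact Finset.sum_congr rfl fun M _ => by ring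
  · intro M _
    refine ((hasFiniteSupport_tower hp t (fun j => t ^ ((M : ℤ) ^ 2 - 2 * n * M) *
      qBinomial (t ^ 4) L M * t ^ e₁ j) M c₁).sub (hasFiniteSupport_tower hp t (fun j =>
      t ^ ((M : ℤ) ^ 2 - 2 * n * M) * qBinomial (t ^ 4) L M * t ^ e₂ j) M c₂)).subset ?_
    intro j hj
    simp only [Function.mem_support, Pi.sub_apply] at hj ⊢
    rw [mul_sub] at hj
    simpa only [mul_assoc] using hj

/-! ### Fermionic sums on a chain of `N` sites -/

/-- The sequence with entries `m` at `1, …, N` and `0` elsewhere. -/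
def chainExt {N : ℕ} (m : Fin N → ℤ) (i : ℕ) : ℤ :=
  if h : 1 ≤ i ∧ i ≤ N then m ⟨i - 1, by omega⟩ else 0

theorem chainExt_zero {N : ℕ} (m : Fin N → ℤ) : chainExt m 0 = 0 := by simp [chainExt]

theorem chainExt_of_lt {N : ℕ} (m : Fin N → ℤ) {i : ℕ} (h : N < i) : chainExt m i = 0 := by
  rw [chainExt, dif_neg (by omega)]

theorem chainExt_succ {N : ℕ} (m : Fin N → ℤ) (j : Fin N) : chainExt m (j + 1) = m j := by
  rw [chainExt, dif_pos (by omega)]; rfl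

theorem chainExt_sub_single {N : ℕ} (m : Fin N → ℤ) {k : ℕ} (hk : k < N) :
    chainExt (m - Pi.single ⟨k, hk⟩ 1) = chainExt m - Pi.single (k + 1) 1 := by
  ext i
  simp only [chainExt, Pi.sub_apply, Pi.single_apply, Fin.ext_iff]
  by_cases h : 1 ≤ i ∧ i ≤ N
  · rw [dif_pos h, dif_pos h]
    congr 2
    simp only [eq_iff_iff]
    omega
  · rw [dif_neg h, dif_neg h, if_neg (by omega), sub_zero]

/-- The row `2 e_i - e_{i-1} - e_{i+1}` for `i = k + 1`. -/
def chainRow (k : ℕ) : ℕ → ℤ := 2 • Pi.single (k + 1) 1 - Pi.single k 1 - Pi.single (k + 2) 1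

/-- The exponent of a summand: the quadratic form of the path of length `N` minus `2 u · x`. -/
def chainExponent (N : ℕ) (u x : ℕ → ℤ) : ℤ :=
  ∑ j ∈ Finset.range (N + 1), (x (j + 1) - x j) ^ 2 - 2 * ∑ j ∈ Finset.range (N + 2), u j * x j

/-- The summand of the fermionic sum on a chain; `u (N + 1)` only fixes the parity of `x N`. -/
noncomputable def chainTerm (t : K) (N : ℕ) (w u x : ℕ → ℤ) : K :=
  if Even (x N + u (N + 1)) then
    t ^ chainExponent N u x *
      ∏ j ∈ Finset.range N, qBinomialHalf (t ^ 4) (x j + x (j + 2) + u (j + 1) + w (j + 1)) (x (j + 1))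
  else 0

/-- The fermionic sum on a chain. -/
noncomputable def chainSum (t : K) (N : ℕ) (w u : ℕ → ℤ) : K :=
  ∑ᶠ m : Fin N → ℤ, chainTerm t N w u (chainExt m)

theorem qBinomialHalf_ne_zero {q : K} {n m : ℤ} (h : qBinomialHalf q n m ≠ 0) :
    Even n ∧ 0 ≤ m ∧ 2 * m ≤ n := by
  rw [qBinomialHalf] at h
  split_ifs at h with he
  · obtain ⟨k, rfl⟩ := he
    rw [show (k + k) / 2 = k by omega] at h
    refine ⟨⟨k, rfl⟩, ?_, ?_⟩
    · by_contra h'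
      exact h (qBinomial_of_neg _ (by omega))
    · by_contra h'
      exact h (qBinomial_of_lt _ (by omega))
  · exact absurd rfl h

theorem qBinomialHalf_pascal {q : K} (hq : ∀ n : ℕ, 0 < n → q ^ n ≠ 1) {n m : ℤ}
    (h : n ≠ 0 ∨ m ≠ 0) : qBinomialHalf q n m =
      q ^ m * qBinomialHalf q (n - 2) m + qBinomialHalf q (n - 2) (m - 1) := by
  rcases Int.even_or_odd n with ⟨k, rfl⟩ | h'
  · rw [qBinomialHalf, qBinomialHalf, qBinomialHalf, if_pos ⟨k, rfl⟩,
      if_pos ⟨k - 1, by ring⟩, if_pos ⟨k - 1, by ring⟩, show (k + k) / 2 = k by omega,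
      show (k + k - 2) / 2 = k - 1 by omega, qBinomial_pascal hq (by omega)]
  · have h1 : ¬ Even n := Int.not_even_iff_odd.2 h'
    have h2 : ¬ Even (n - 2) := fun h => h1 (by simpa using h.add even_two)
    rw [qBinomialHalf, qBinomialHalf, qBinomialHalf, if_neg h1, if_neg h2, if_neg h2]
    simp

theorem sum_mul_single {n k : ℕ} (hk : k < n) (f : ℕ → ℤ) (c : ℤ) :
    ∑ j ∈ Finset.range n, f j * (Pi.single k c : ℕ → ℤ) j = f k * c := by
  simp [Pi.single_apply, hk]

theorem sum_mul_single_succ {n k : ℕ} (hk : k < n) (f : ℕ → ℤ) (c : ℤ) :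
    ∑ j ∈ Finset.range n, f j * (Pi.single (k + 1) c : ℕ → ℤ) (j + 1) = f k * c := by
  simp [Pi.single_apply, hk]

theorem chainExponent_sub_two {N k : ℕ} (hk : k < N) (u x : ℕ → ℤ) :
    chainExponent N (u - 2 • Pi.single (k + 1) 1) x = chainExponent N u x + 4 * x (k + 1) := by
  have h := sum_mul_single (show k + 1 < N + 2 by omega) x 1
  simp only [chainExponent, Pi.sub_apply, Pi.smul_apply, sub_mul, Finset.sum_sub_distrib]
  have h2 : ∑ j ∈ Finset.range (N + 2), 2 • (Pi.single (k + 1) 1 : ℕ → ℤ) j * x j =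
      2 * x (k + 1) := by
    rw [← mul_one (x (k + 1)), ← h, Finset.mul_sum]
    exact Finset.sum_congr rfl fun j _ => by rw [nsmul_eq_mul]; push_cast; ring
  rw [h2]
  ring

/-- Write the exponent as `x C x - 2 u · x` with `C` the symmetric matrix of the path, and let `e`
be the unit vector at `k + 1`, so that `chainRow k` is `C e`. When `x` and `u` are shifted by `e`
and `C e`, the cross terms `x C e` cancel and only constants and `u (k + 1)` remain. -/
theorem chainExponent_sub_row {N k : ℕ} (hk : k < N) (u x : ℕ → ℤ) :
    chainExponent N u x =
      2 - 2 * u (k + 1) + chainExponent N (u - chainRow k) (x - Pi.single (k + 1) 1) := by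
  have hd : ∀ f : ℕ → ℤ, ∑ j ∈ Finset.range (N + 1),
      f j * ((Pi.single (k + 1) 1 : ℕ → ℤ) (j + 1) - (Pi.single (k + 1) 1 : ℕ → ℤ) j) =
      f k - f (k + 1) := fun f => by
    simp only [mul_sub, Finset.sum_sub_distrib]
    rw [sum_mul_single (by omega), sum_mul_single_succ (by omega)]
    ring
  have hs : ∀ i < N + 2, ∀ f : ℕ → ℤ,
      ∑ j ∈ Finset.range (N + 2), f j * (Pi.single i 1 : ℕ → ℤ) j = f i := fun i hi f => by
    rw [sum_mul_single hi, mul_one]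
  have hR : ∀ f : ℕ → ℤ, ∑ j ∈ Finset.range (N + 2), f j * chainRow k j =
      2 * f (k + 1) - f k - f (k + 2) := fun f => by
    have e : ∀ j, f j * chainRow k j = 2 * (f j * (Pi.single (k + 1) 1 : ℕ → ℤ) j) -
        f j * (Pi.single k 1 : ℕ → ℤ) j - f j * (Pi.single (k + 2) 1 : ℕ → ℤ) j := fun j => by
      rw [chainRow, Pi.sub_apply, Pi.sub_apply, Pi.smul_apply, nsmul_eq_mul]
      push_cast
      ring
    simp only [e, Finset.sum_sub_distrib, ← Finset.mul_sum]
    rw [hs k (by omega), hs (k + 1) (by omega), hs (k + 2) (by omega)]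
  have hQ : ∑ j ∈ Finset.range (N + 1), ((x - Pi.single (k + 1) 1 : ℕ → ℤ) (j + 1) -
      (x - Pi.single (k + 1) 1 : ℕ → ℤ) j) ^ 2 =
      ∑ j ∈ Finset.range (N + 1), (x (j + 1) - x j) ^ 2 -
        2 * (2 * x (k + 1) - x k - x (k + 2)) + 2 := by
    have e : ∀ j, ((x - Pi.single (k + 1) 1 : ℕ → ℤ) (j + 1) -
        (x - Pi.single (k + 1) 1 : ℕ → ℤ) j) ^ 2 = (x (j + 1) - x j) ^ 2 -
        2 * ((x (j + 1) - x j) *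
          ((Pi.single (k + 1) 1 : ℕ → ℤ) (j + 1) - (Pi.single (k + 1) 1 : ℕ → ℤ) j)) +
        ((Pi.single (k + 1) 1 : ℕ → ℤ) (j + 1) - (Pi.single (k + 1) 1 : ℕ → ℤ) j) *
          ((Pi.single (k + 1) 1 : ℕ → ℤ) (j + 1) - (Pi.single (k + 1) 1 : ℕ → ℤ) j) := fun j => by
      rw [Pi.sub_apply, Pi.sub_apply]; ring
    simp only [e, Finset.sum_add_distrib, Finset.sum_sub_distrib, ← Finset.mul_sum]
    rw [hd fun j => x (j + 1) - x j,
      hd fun j => (Pi.single (k + 1) 1 : ℕ → ℤ) (j + 1) - (Pi.single (k + 1) 1 : ℕ → ℤ) j]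
    simp only [Pi.single_apply]
    norm_num
    ring
  have hL : ∑ j ∈ Finset.range (N + 2), (u - chainRow k) j * (x - Pi.single (k + 1) 1 : ℕ → ℤ) j =
      ∑ j ∈ Finset.range (N + 2), u j * x j - u (k + 1) - (2 * x (k + 1) - x k - x (k + 2)) + 2 := by
    have e : ∀ j, (u - chainRow k) j * (x - Pi.single (k + 1) 1 : ℕ → ℤ) j =
        u j * x j - u j * (Pi.single (k + 1) 1 : ℕ → ℤ) j - x j * chainRow k j +
          (Pi.single (k + 1) 1 : ℕ → ℤ) j * chainRow k j := fun j => by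
      rw [Pi.sub_apply, Pi.sub_apply]; ring
    simp only [e, Finset.sum_add_distrib, Finset.sum_sub_distrib]
    rw [hs (k + 1) (by omega), hR x, hR]
    simp
  rw [chainExponent, chainExponent, hQ, hL]
  ring

/-- This is Pascal's rule in the factor at site `k + 1`. The part with unchanged lower entry has `u`
lowered by 2 there, its factor `q ^ x` being absorbed in the exponent. In the other part `x` is
lowered by one at the site; subtracting `chainRow k` from `u` compensates for this in the
neighbouring upper entries. -/
theorem chainTerm_split {t : K} (ht0 : t ≠ 0) (ht : ∀ n : ℕ, 0 < n → t ^ n ≠ 1) {N k : ℕ}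
    (hk : k < N) {w u x : ℕ → ℤ} (hx0 : x 0 = 0) (hxN : x (N + 1) = 0)
    (hu : 1 ≤ u (k + 1) + w (k + 1)) :
    chainTerm t N w u x = chainTerm t N w (u - 2 • Pi.single (k + 1) 1) x +
      t ^ (2 - 2 * u (k + 1)) *
        chainTerm t N w (u - chainRow k) (x - Pi.single (k + 1) 1) := by
  have e1 : (u - 2 • Pi.single (k + 1) 1 : ℕ → ℤ) (N + 1) = u (N + 1) := by
    simp [hk.ne']
  have e2 : (x - Pi.single (k + 1) 1 : ℕ → ℤ) N + (u - chainRow k) (N + 1) = x N + u (N + 1) := by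
    simp only [chainRow, Pi.sub_apply, Pi.smul_apply, Pi.single_apply]
    split_ifs <;> first | omega | simp
  rw [chainTerm, chainTerm, chainTerm, e1, e2]
  split_ifs
  · rw [chainExponent_sub_two hk, zpow_add₀ ht0, ← pow_four_zpow]
    have hmem := Finset.mem_range.2 hk
    rw [← Finset.mul_prod_erase _ _ hmem, ← Finset.mul_prod_erase _ _ hmem,
      ← Finset.mul_prod_erase _ _ hmem]
    have p1 : ∏ j ∈ (Finset.range N).erase k, qBinomialHalf (t ^ 4)
        (x j + x (j + 2) + (u - 2 • Pi.single (k + 1) 1 : ℕ → ℤ) (j + 1) + w (j + 1)) (x (j + 1)) =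
        ∏ j ∈ (Finset.range N).erase k, qBinomialHalf (t ^ 4)
          (x j + x (j + 2) + u (j + 1) + w (j + 1)) (x (j + 1)) := by
      refine Finset.prod_congr rfl fun j hj => ?_
      rw [show (u - 2 • Pi.single (k + 1) 1 : ℕ → ℤ) (j + 1) = u (j + 1) by
        simp [Finset.ne_of_mem_erase hj]]
    have p2 : ∏ j ∈ (Finset.range N).erase k, qBinomialHalf (t ^ 4)
        ((x - Pi.single (k + 1) 1 : ℕ → ℤ) j + (x - Pi.single (k + 1) 1 : ℕ → ℤ) (j + 2) +
          (u - chainRow k) (j + 1) + w (j + 1)) ((x - Pi.single (k + 1) 1 : ℕ → ℤ) (j + 1)) =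
        ∏ j ∈ (Finset.range N).erase k, qBinomialHalf (t ^ 4)
          (x j + x (j + 2) + u (j + 1) + w (j + 1)) (x (j + 1)) := by
      refine Finset.prod_congr rfl fun j hj => ?_
      have hjk := Finset.ne_of_mem_erase hj
      rw [show (x - Pi.single (k + 1) 1 : ℕ → ℤ) (j + 1) = x (j + 1) by simp [hjk]]
      congr 2
      simp only [chainRow, Pi.sub_apply, Pi.smul_apply, Pi.single_apply]
      split_ifs <;> first | omega | (simp; done) | (simp; ring)
    rw [p1, p2]
    -- If the other factors do not vanish, the neighbours of the site are nonnegative, so `hu` makes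
    -- the upper entry positive and the exceptional case of Pascal's rule is avoided.
    by_cases hP : ∏ j ∈ (Finset.range N).erase k, qBinomialHalf (t ^ 4)
        (x j + x (j + 2) + u (j + 1) + w (j + 1)) (x (j + 1)) = 0
    · simp [hP]
    · have hpos : ∀ j, j ≤ N + 1 → j ≠ k + 1 → 0 ≤ x j := fun j hj hjk => by
        rcases Nat.eq_zero_or_pos j with rfl | h0
        · exact hx0.ge
        rcases hj.lt_or_eq with h1 | rfl
        · obtain ⟨i, rfl⟩ : ∃ i, j = i + 1 := ⟨j - 1, by omega⟩
          exact (qBinomialHalf_ne_zero (Finset.prod_ne_zero_iff.1 hP i (Finset.mem_erase.2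
            ⟨by omega, Finset.mem_range.2 (by omega)⟩))).2.1
        · exact hxN.ge
      have h1 := hpos k (by omega) (by omega)
      have h2 := hpos (k + 2) (by omega) (by omega)
      rw [qBinomialHalf_pascal (pow_four_ne_one ht) (n := x k + x (k + 2) + u (k + 1) + w (k + 1))
        (Or.inl (by omega))]
      have a1 : x k + x (k + 2) + (u - 2 • Pi.single (k + 1) 1 : ℕ → ℤ) (k + 1) + w (k + 1) =
          x k + x (k + 2) + u (k + 1) + w (k + 1) - 2 := by simp; ring
      have a2 : (x - Pi.single (k + 1) 1 : ℕ → ℤ) k + (x - Pi.single (k + 1) 1 : ℕ → ℤ) (k + 2) +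
          (u - chainRow k) (k + 1) + w (k + 1) =
          x k + x (k + 2) + u (k + 1) + w (k + 1) - 2 := by simp [chainRow]; ring
      have a3 : (x - Pi.single (k + 1) 1 : ℕ → ℤ) (k + 1) = x (k + 1) - 1 := by simp
      have hE := zpow_add₀ ht0 (2 - 2 * u (k + 1))
        (chainExponent N (u - chainRow k) (x - Pi.single (k + 1) 1))
      rw [← chainExponent_sub_row hk] at hE
      rw [a1, a2, a3, ← mul_assoc (t ^ (2 - 2 * u (k + 1))), ← hE]
      ring
  · simp

/-- The slopes of a nonnegative sequence ending in `0` whose second differences are bounded below. -/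
theorem slope_le_of_second_difference {N : ℕ} {x c : ℕ → ℤ} (hc : ∀ j < N, 0 ≤ c j)
    (hx : ∀ j < N, 2 * x (j + 1) ≤ x j + x (j + 2) + c j) (hpos : ∀ j ≤ N, 0 ≤ x j)
    (hN : x (N + 1) = 0) {i : ℕ} (hi : i ≤ N) :
    x (i + 1) - x i ≤ max 0 (∑ j ∈ Finset.range N, c j - 1) := by
  by_contra! h
  obtain ⟨h1, h2⟩ := max_lt_iff.1 h
  have hU : ∀ j ≤ N, ∑ l ∈ Finset.Ico i j, c l ≤ ∑ l ∈ Finset.range N, c l := fun j hj =>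
    Finset.sum_le_sum_of_subset_of_nonneg
      (fun l hl => Finset.mem_range.2 ((Finset.mem_Ico.1 hl).2.trans_le hj))
      fun l hl _ => hc l (Finset.mem_range.1 hl)
  -- A slope that is positive and at least the total of `c` can never turn negative later on, so `x`
  -- does not decrease from `i + 1` on and cannot return to 0 at `N + 1`.
  have key : ∀ j, i ≤ j → j ≤ N → x (i + 1) - x i - ∑ l ∈ Finset.Ico i j, c l ≤ x (j + 1) - x j ∧
      x (i + 1) ≤ x (j + 1) := fun j hij => by
    induction j, hij using Nat.le_induction with
    | base => simp
    | succ j hij ih =>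
      intro hj
      have := ih (by omega)
      have h3 := hx j (by omega)
      have h4 := hU (j + 1) hj
      rw [Finset.sum_Ico_succ_top hij] at h4 ⊢
      constructor <;> linarith
  have := (key N hi le_rfl).2
  have := hpos i hi
  omega

theorem chainTerm_ne_zero {t : K} {N : ℕ} {w u x : ℕ → ℤ} (h : chainTerm t N w u x ≠ 0) :
    Even (x N + u (N + 1)) ∧ ∀ j < N, Even (x j + x (j + 2) + u (j + 1) + w (j + 1)) ∧
      0 ≤ x (j + 1) ∧ 2 * x (j + 1) ≤ x j + x (j + 2) + u (j + 1) + w (j + 1) := by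
  rw [chainTerm] at h
  split_ifs at h with h1
  · exact ⟨h1, fun j hj => qBinomialHalf_ne_zero (Finset.prod_ne_zero_iff.1
      (right_ne_zero_of_mul h) j (Finset.mem_range.2 hj))⟩
  · exact absurd rfl h

/-- Nonvanishing binomials force `x ≥ 0` and bound the second differences from below. All slopes are
then at most `B`, and `x i ≤ i B` because `x 0 = 0`. -/
theorem hasFiniteSupport_chainTerm (t : K) (N : ℕ) (w u : ℕ → ℤ) :
    Function.HasFiniteSupport fun m : Fin N → ℤ => chainTerm t N w u (chainExt m) := by
  set B : ℤ := max 0 (∑ j ∈ Finset.range N, |u (j + 1) + w (j + 1)| - 1) with hB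
  refine (Set.finite_Icc (0 : Fin N → ℤ) fun _ => N * B).subset fun m hm => ?_
  have h := (chainTerm_ne_zero hm).2
  have hpos : ∀ j ≤ N, 0 ≤ chainExt m j := fun j hj => by
    rcases j with _ | j
    · exact (chainExt_zero m).ge
    · exact (h j (by omega)).2.1
  have hs : ∀ i ≤ N, chainExt m (i + 1) - chainExt m i ≤ B := fun i hi =>
    slope_le_of_second_difference (c := fun j => |u (j + 1) + w (j + 1)|)
      (fun j _ => abs_nonneg _) (fun j hj => by
        have := (h j hj).2.2
        have := le_abs_self (u (j + 1) + w (j + 1))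
        linarith) hpos (chainExt_of_lt m (by omega)) hi
  have hB0 : 0 ≤ B := le_max_left _ _
  have hx : ∀ i ≤ N, chainExt m i ≤ i * B := fun i => by
    induction i with
    | zero => intro _; simp [chainExt_zero]
    | succ i ih =>
      intro hi
      have h1 := ih (by omega)
      have h2 := hs i (by omega)
      push_cast
      linarith
  rw [Set.mem_Icc]
  constructor <;> intro j
  · rw [← chainExt_succ m j]
    exact hpos _ j.2
  · rw [← chainExt_succ m j]
    refine (hx _ j.2).trans (mul_le_mul_of_nonneg_right ?_ hB0)
    have := j.2
    exact_mod_cast this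

theorem chainSum_split {t : K} (ht0 : t ≠ 0) (ht : ∀ n : ℕ, 0 < n → t ^ n ≠ 1) {N k : ℕ}
    (hk : k < N) {w u : ℕ → ℤ} (hu : 1 ≤ u (k + 1) + w (k + 1)) :
    chainSum t N w u = chainSum t N w (u - 2 • Pi.single (k + 1) 1) +
      t ^ (2 - 2 * u (k + 1)) * chainSum t N w (u - chainRow k) := by
  have h : ∀ m : Fin N → ℤ, chainTerm t N w u (chainExt m) =
      chainTerm t N w (u - 2 • Pi.single (k + 1) 1) (chainExt m) + t ^ (2 - 2 * u (k + 1)) *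
        chainTerm t N w (u - chainRow k) (chainExt (Equiv.subRight (Pi.single ⟨k, hk⟩ 1) m)) :=
    fun m => by
      rw [Equiv.subRight_apply, chainExt_sub_single m hk]
      exact chainTerm_split ht0 ht hk (chainExt_zero m) (chainExt_of_lt m (by omega)) hu
  have hf := (hasFiniteSupport_chainTerm t N w (u - chainRow k)).preimage
    (Equiv.subRight (Pi.single (⟨k, hk⟩ : Fin N) (1 : ℤ))).injective.injOn
  rw [chainSum, finsum_congr h, finsum_add_distrib (hasFiniteSupport_chainTerm _ _ _ _), ← mul_finsum,
    finsum_comp_equiv (Equiv.subRight (Pi.single (⟨k, hk⟩ : Fin N) (1 : ℤ)))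
      (f := fun m => chainTerm t N w (u - chainRow k) (chainExt m))]
  · rfl
  · refine hf.subset fun m hm => ?_
    exact right_ne_zero_of_mul hm

/-- The entry of `u` at 0 is invisible, and the one at `N + 1` matters only modulo 2. A unit source
pushed off either end of the chain is therefore lost or merely flips the parity condition. -/
theorem chainTerm_congr (t : K) {N : ℕ} (w : ℕ → ℤ) {u u' x : ℕ → ℤ} (hx0 : x 0 = 0)
    (hxN : x (N + 1) = 0) (h : ∀ j < N, u (j + 1) = u' (j + 1))
    (hN : Even (u (N + 1) - u' (N + 1))) : chainTerm t N w u x = chainTerm t N w u' x := by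
  have h1 : Even (x N + u (N + 1)) ↔ Even (x N + u' (N + 1)) := by
    rw [Int.even_add, Int.even_add, Int.even_sub.1 hN]
  have h2 : chainExponent N u x = chainExponent N u' x := by
    rw [chainExponent, chainExponent]
    congr 2
    refine Finset.sum_congr rfl fun j hj => ?_
    rcases j with _ | j
    · rw [hx0, mul_zero, mul_zero]
    · rcases lt_or_ge j N with hj' | hj'
      · rw [h j hj']
      · rw [show j = N by rw [Finset.mem_range] at hj; omega, hxN, mul_zero, mul_zero]
  rw [chainTerm, chainTerm, h2]
  simp only [h1]
  congr 2
  exact Finset.prod_congr rfl fun j hj => by rw [h j (Finset.mem_range.1 hj)]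

theorem chainSum_congr (t : K) {N : ℕ} (w : ℕ → ℤ) {u u' : ℕ → ℤ} (h : ∀ j < N, u (j + 1) = u' (j + 1))
    (hN : Even (u (N + 1) - u' (N + 1))) : chainSum t N w u = chainSum t N w u' :=
  finsum_congr fun m => chainTerm_congr t w (chainExt_zero m) (chainExt_of_lt m (by omega)) h hN

/-! ### Recurrence of the chain sums in the strength `M` of the first source -/

/-- The vector `M e_1 + e_b + κ e_{N+1}`. -/
def chainSource (N : ℕ) (M : ℤ) (b : ℕ) (κ : ℤ) : ℕ → ℤ :=
  Pi.single 1 M + Pi.single b 1 + Pi.single (N + 1) κ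

/-- Splitting at site `k + 1` moves the dipole `-e_k + e_{k+1}` one site to the right and leaves
behind a term with the pair `-e_k - e_{k+1}`. -/
theorem chainSource_forward {t : K} (ht0 : t ≠ 0) (ht : ∀ n : ℕ, 0 < n → t ^ n ≠ 1) {N b k : ℕ}
    (hkb : k < b) (hb : b ≤ N) {w : ℕ → ℤ} (hw : ∀ j, 0 ≤ w j) {M : ℤ} (hM : 0 ≤ M) (κ : ℤ) :
    chainSum t N w (chainSource N M b κ - Pi.single k 1 + Pi.single (k + 1) 1) =
      chainSum t N w (chainSource N M b κ - Pi.single k 1 - Pi.single (k + 1) 1) +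
      t ^ (-2 * (if k = 0 then M else 0) - 2 * if k + 1 = b then 1 else 0) *
        chainSum t N w
          (chainSource N M b κ - Pi.single (k + 1) 1 + Pi.single (k + 1 + 1) 1) := by
  have e : (chainSource N M b κ - Pi.single k 1 + Pi.single (k + 1) 1 : ℕ → ℤ) (k + 1) =
      1 + (if k = 0 then M else 0) + if k + 1 = b then 1 else 0 := by
    simp only [chainSource, Pi.add_apply, Pi.sub_apply, Pi.single_apply]
    split_ifs <;> omega
  have h0 : 0 ≤ (if k = 0 then M else 0) := by split_ifs <;> omega
  have h1 : 0 ≤ (if k + 1 = b then (1 : ℤ) else 0) := by split_ifs <;> omega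
  rw [chainSum_split ht0 ht (show k < N by omega) (by have := hw (k + 1); rw [e]; omega), e]
  congr 2
  · abel
  · congr 1; ring
  · rw [chainRow, show k + 1 + 1 = k + 2 from rfl]; congr 1; abel

/-- The mirror image of `chainSource_forward`: the dipole `e_{k+1} - e_{k+2}` moves left and leaves
a pair `-e_{k+1} - e_{k+2}` of the same form as in the forward motion. -/
theorem chainSource_backward {t : K} (ht0 : t ≠ 0) (ht : ∀ n : ℕ, 0 < n → t ^ n ≠ 1) {N b k : ℕ}
    (hkb : k + 1 < b) (hb : b ≤ N) {w : ℕ → ℤ} (hw : ∀ j, 0 ≤ w j) {M : ℤ} (hM : 0 ≤ M) (κ : ℤ) :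
    chainSum t N w (chainSource N M b κ - Pi.single (k + 2) 1 + Pi.single (k + 1) 1) =
      chainSum t N w (chainSource N M b κ - Pi.single (k + 1) 1 - Pi.single (k + 2) 1) +
      t ^ (-2 * if k = 0 then M else 0) *
        chainSum t N w (chainSource N M b κ - Pi.single (k + 1) 1 + Pi.single k 1) := by
  have e : (chainSource N M b κ - Pi.single (k + 2) 1 + Pi.single (k + 1) 1 : ℕ → ℤ) (k + 1) =
      1 + if k = 0 then M else 0 := by
    simp only [chainSource, Pi.add_apply, Pi.sub_apply, Pi.single_apply]
    split_ifs <;> omega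
  have h0 : 0 ≤ (if k = 0 then M else 0) := by split_ifs <;> omega
  rw [chainSum_split ht0 ht (show k < N by omega) (by have := hw (k + 1); rw [e]; omega), e]
  congr 2
  · abel
  · congr 1; ring
  · rw [chainRow]; congr 1; abel

theorem chainSum_source_shift (t : K) {N b : ℕ} (w : ℕ → ℤ) (M κ : ℤ) :
    chainSum t N w (chainSource N (M + 1) b κ) =
        chainSum t N w (chainSource N M b κ - Pi.single 0 1 + Pi.single 1 1) ∧
      chainSum t N w (chainSource N (M - 1) b κ) =
        chainSum t N w (chainSource N M b κ - Pi.single 0 1 - Pi.single 1 1) ∧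
      chainSum t N w (chainSource N (M - 1) b κ) =
        chainSum t N w (chainSource N M b κ - Pi.single 1 1 + Pi.single 0 1) := by
  refine ⟨chainSum_congr t w (fun j _ => ?_) ?_, chainSum_congr t w (fun j _ => ?_) ?_,
    chainSum_congr t w (fun j _ => ?_) ?_⟩ <;>
  · simp only [chainSource, Pi.add_apply, Pi.sub_apply, Pi.single_apply]
    split_ifs <;> first | contradiction | omega | (rw [Int.even_iff]; omega)

/-- Raising `M` by one is inserting the dipole `-e_0 + e_1`, as `e_0` is invisible. The dipole then
travels to site `b`, where it carries the unit source to `b + 1`. Crossing site 1 costs `t ^ (-2 M)`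
and crossing site `b` costs `t ^ (-2)`. -/
theorem chainSum_source_succ {t : K} (ht0 : t ≠ 0) (ht : ∀ n : ℕ, 0 < n → t ^ n ≠ 1) {N b : ℕ}
    (hb0 : 1 ≤ b) (hb : b ≤ N) {w : ℕ → ℤ} (hw : ∀ j, 0 ≤ w j) {M : ℤ} (hM : 0 ≤ M) (κ : ℤ) :
    chainSum t N w (chainSource N (M + 1) b κ) = chainSum t N w (chainSource N (M - 1) b κ) +
      t ^ (-2 * M) * (∑ i ∈ Finset.Ico 1 b, chainSum t N w
        (chainSource N M b κ - Pi.single i 1 - Pi.single (i + 1) 1) +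
      t ^ (-2 : ℤ) * chainSum t N w (chainSource N M (b + 1) κ)) := by
  have hV : chainSource N M b κ - Pi.single b 1 + Pi.single (b + 1) 1 = chainSource N M (b + 1) κ := by
    rw [chainSource, chainSource]; abel
  have key : ∀ k, 1 ≤ k → k < b →
      chainSum t N w (chainSource N M b κ - Pi.single 1 1 + Pi.single (1 + 1) 1) =
      ∑ i ∈ Finset.Ico 1 k, chainSum t N w
        (chainSource N M b κ - Pi.single i 1 - Pi.single (i + 1) 1) +
      chainSum t N w (chainSource N M b κ - Pi.single k 1 + Pi.single (k + 1) 1) := fun k hk => by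
    induction k, hk using Nat.le_induction with
    | base => simp
    | succ k hk ih =>
      intro hkb
      rw [ih (by omega), chainSource_forward ht0 ht (k := k) (by omega) hb hw hM κ,
        if_neg (by omega), if_neg (by omega), Finset.sum_Ico_succ_top hk]
      simp [add_assoc]
  obtain ⟨h1, h2, -⟩ := chainSum_source_shift t (N := N) (b := b) w M κ
  have h0 := chainSource_forward ht0 ht (k := 0) (by omega) hb hw hM κ
  rw [zero_add, ← h1, ← h2, if_pos rfl] at h0
  rw [h0]
  congr 1
  rcases hb0.eq_or_lt with rfl | hb1
  · rw [if_pos rfl, hV, Finset.Ico_self, Finset.sum_empty, zero_add, ← mul_assoc,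
      ← zpow_add₀ ht0]
    rfl
  · have h3 := chainSource_forward ht0 ht (k := b - 1) (by omega) hb hw hM κ
    rw [if_neg (by omega), if_pos (by omega), Nat.sub_add_cancel hb0, hV] at h3
    have h4 := key (b - 1) (by omega) (by omega)
    rw [Nat.sub_add_cancel hb0, h3, ← add_assoc] at h4
    have h5 := Finset.sum_Ico_succ_top (show 1 ≤ b - 1 by omega) fun i => chainSum t N w
      (chainSource N M b κ - Pi.single i 1 - Pi.single (i + 1) 1)
    rw [Nat.sub_add_cancel hb0] at h5
    rw [if_neg (by omega), h4, h5]
    simp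

/-- A source at `b` is a source at `b + 1` with a dipole, which is sent back to the left end, where
it leaves as `M - 1`. The intermediate sum is the one occurring in `chainSum_source_succ` at `b +
1`. -/
theorem chainSum_source_pred {t : K} (ht0 : t ≠ 0) (ht : ∀ n : ℕ, 0 < n → t ^ n ≠ 1) {N b : ℕ}
    (hb1 : 1 ≤ b) (hb : b + 1 ≤ N) {w : ℕ → ℤ} (hw : ∀ j, 0 ≤ w j) {M : ℤ} (hM : 0 ≤ M) (κ : ℤ) :
    chainSum t N w (chainSource N M b κ) =
      ∑ i ∈ Finset.Ico 1 (b + 1), chainSum t N w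
        (chainSource N M (b + 1) κ - Pi.single i 1 - Pi.single (i + 1) 1) +
      t ^ (-2 * M) * chainSum t N w (chainSource N (M - 1) (b + 1) κ) := by
  have hU : chainSource N M (b + 1) κ - Pi.single (b + 1) 1 + Pi.single b 1 = chainSource N M b κ := by
    rw [chainSource, chainSource]; abel
  obtain ⟨-, -, h2⟩ := chainSum_source_shift t (N := N) (b := b + 1) w M κ
  have key : ∀ k, 1 ≤ k → k < b + 1 →
      chainSum t N w (chainSource N M (b + 1) κ - Pi.single (k + 1) 1 + Pi.single k 1) =
      ∑ i ∈ Finset.Ico 1 (k + 1), chainSum t N w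
        (chainSource N M (b + 1) κ - Pi.single i 1 - Pi.single (i + 1) 1) +
      t ^ (-2 * M) * chainSum t N w (chainSource N (M - 1) (b + 1) κ) := fun k hk => by
    induction k, hk using Nat.le_induction with
    | base =>
      intro _
      have h0 := chainSource_backward ht0 ht (k := 0) (by omega) hb hw hM κ
      rw [zero_add, ← h2, if_pos rfl] at h0
      rw [h0]
      simp
    | succ k hk ih =>
      intro hkb
      rw [chainSource_backward ht0 ht (k := k) (by omega) hb hw hM κ, ih (by omega),
        if_neg (by omega), Finset.sum_Ico_succ_top (show 1 ≤ k + 1 by omega)]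
      simp
      ring
  rw [← hU]
  exact key b hb1 (by omega)

/-- The recurrence of the fermionic sums away from the first site. -/
theorem chainSum_source_rec {t : K} (ht0 : t ≠ 0) (ht : ∀ n : ℕ, 0 < n → t ^ n ≠ 1) {N b : ℕ}
    (hb1 : 1 ≤ b) (hb : b + 1 ≤ N) {w : ℕ → ℤ} (hw : ∀ j, 0 ≤ w j) {M : ℤ} (hM : 0 ≤ M) (κ : ℤ) :
    chainSum t N w (chainSource N (M + 1) (b + 1) κ) =
      t ^ (-2 * M - 2) * chainSum t N w (chainSource N M (b + 2) κ) +
      t ^ (-2 * M) * chainSum t N w (chainSource N M b κ) +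
      (1 - t ^ (-4 * M)) * chainSum t N w (chainSource N (M - 1) (b + 1) κ) := by
  -- The two expansions share the sum over pairs, which cancels in the final `ring`.
  rw [chainSum_source_succ ht0 ht (by omega) hb hw hM κ, chainSum_source_pred ht0 ht hb1 hb hw hM κ,
    show -2 * M - 2 = -2 * M + -2 by ring, zpow_add₀ ht0, show -4 * M = -2 * M + -2 * M by ring,
    zpow_add₀ ht0]
  ring

theorem chainSum_source_zero (t : K) {N : ℕ} (w : ℕ → ℤ) (M κ : ℤ) :
    chainSum t N w (chainSource N (M + 1) 0 κ) = chainSum t N w (chainSource N M 1 κ) := by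
  refine chainSum_congr t w (fun j _ => ?_) ?_ <;>
  · simp only [chainSource, Pi.add_apply, Pi.single_apply]
    split_ifs <;> first | contradiction | omega | (rw [Int.even_iff]; omega)

/-- The recurrence of the fermionic sums at the first site. -/
theorem chainSum_source_one {t : K} (ht0 : t ≠ 0) (ht : ∀ n : ℕ, 0 < n → t ^ n ≠ 1) {N : ℕ}
    (hN : 1 ≤ N) {w : ℕ → ℤ} (hw : ∀ j, 0 ≤ w j) {M : ℤ} (hM : 0 ≤ M) (κ : ℤ) :
    chainSum t N w (chainSource N (M + 1) 1 κ) = chainSum t N w (chainSource N M 0 κ) +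
      t ^ (-2 * M - 2) * chainSum t N w (chainSource N M 2 κ) := by
  have h := chainSum_source_zero t (N := N) w (M - 1) κ
  rw [sub_add_cancel] at h
  rw [chainSum_source_succ ht0 ht le_rfl hN hw hM κ, h, show -2 * M - 2 = -2 * M + -2 by ring,
    zpow_add₀ ht0]
  simp [mul_assoc]

/-- A unit source at `N + 1` only flips the parity of `x N`, and so does `κ`; two flips cancel. -/
theorem chainSum_source_top (t : K) {N : ℕ} (w : ℕ → ℤ) (M : ℤ) :
    chainSum t N w (chainSource N M (N + 1) 0) = chainSum t N w (chainSource N M 0 1) ∧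
      chainSum t N w (chainSource N M (N + 1) 1) = chainSum t N w (chainSource N M 0 0) := by
  refine ⟨chainSum_congr t w (fun j hj => ?_) ?_, chainSum_congr t w (fun j hj => ?_) ?_⟩ <;>
  · simp only [chainSource, Pi.add_apply, Pi.single_apply]
    split_ifs <;> first | contradiction | omega | (rw [Int.even_iff]; omega)

/-! ### Evaluation of the chain sums at `M = 0` -/

theorem sum_sq_slope (x : ℕ → ℤ) (n : ℕ) : ∑ j ∈ Finset.range (n + 1), (x (j + 1) - x j) ^ 2 =
    ∑ j ∈ Finset.range n, x (j + 1) * (2 * x (j + 1) - x j - x (j + 2)) +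
      x (n + 1) * (x (n + 1) - x n) - x 0 * (x 1 - x 0) := by
  induction n with
  | zero => simp; ring
  | succ n ih => rw [Finset.sum_range_succ, ih, Finset.sum_range_succ]; ring

theorem sum_sign_slope {x : ℕ → ℤ} (h0 : x 0 = 0) (a n : ℕ) :
    ∑ j ∈ Finset.range n, (if j < a then 1 else -1) * (x (j + 1) - x j) =
      if n ≤ a then x n else 2 * x a - x n := by
  induction n with
  | zero => simp [h0]
  | succ n ih =>
    rw [Finset.sum_range_succ, ih]
    rcases lt_trichotomy n a with h | rfl | h
    · rw [if_pos h.le, if_pos h, if_pos (by omega)]; ring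
    · simp; ring
    · rw [if_neg (by omega), if_neg (by omega), if_neg (by omega)]; ring

theorem chainSource_zero_apply (N b : ℕ) (κ : ℤ) {j : ℕ} (hj : j < N) :
    chainSource N 0 b κ (j + 1) = if j + 1 = b then 1 else 0 := by
  simp [chainSource, Pi.single_apply, hj.ne]

/-- Without a source at the left end, the constraints on a nonzero summand are all saturated. -/
theorem saturated_of_chainTerm_ne_zero {t : K} {N a b : ℕ} (ha : a ≤ N) (hb : b ≤ N) {κ : ℤ}
    {x : ℕ → ℤ} (h0 : x 0 = 0) (hN : x (N + 1) = 0)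
    (h : chainTerm t N (Pi.single a 1) (chainSource N 0 b κ) x ≠ 0) :
    ∑ j ∈ Finset.range (N + 1), (x (j + 1) - x j) ^ 2 = 2 * x b ∧
    (∀ j ≤ N, (x (j + 1) - x j) ^ 2 = (if j < a then 1 else -1) * (x (j + 1) - x j)) ∧
    (∀ j ≤ N, (x (j + 1) - x j) ^ 2 = (if j < b then 1 else -1) * (x (j + 1) - x j)) ∧
    ∀ j < N, x (j + 1) * (x j + x (j + 2) + (if j + 1 = b then 1 else 0) +
      (if j + 1 = a then 1 else 0) - 2 * x (j + 1)) = 0 := by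
  have hh := (chainTerm_ne_zero h).2
  have hw : ∀ j, (Pi.single a 1 : ℕ → ℤ) j = if j = a then 1 else 0 := fun j => Pi.single_apply ..
  have hδ : ∀ c ≤ N, ∑ j ∈ Finset.range N, x (j + 1) * (if j + 1 = c then 1 else 0) = x c :=
    fun c hc => by
      rcases c with _ | c
      · simp [h0]
      · simp [show c < N by omega]
  have hsgn : ∀ c ≤ N, ∑ j ∈ Finset.range (N + 1), (if j < c then 1 else -1) * (x (j + 1) - x j) =
      2 * x c := fun c hc => by
    rw [sum_sign_slope h0, if_neg (by omega), hN, sub_zero]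
  have hS := sum_sq_slope x N
  rw [h0, hN] at hS
  -- Summation by parts: the entries weighted by the slack in their binomials.
  have hT : ∑ j ∈ Finset.range N, x (j + 1) * (x j + x (j + 2) + (if j + 1 = b then 1 else 0) +
      (if j + 1 = a then 1 else 0) - 2 * x (j + 1)) =
      x a + x b - ∑ j ∈ Finset.range (N + 1), (x (j + 1) - x j) ^ 2 := by
    rw [hS, ← hδ a ha, ← hδ b hb]
    simp only [zero_mul, add_zero, sub_zero]
    rw [← Finset.sum_add_distrib, ← Finset.sum_sub_distrib]
    exact Finset.sum_congr rfl fun j _ => by ring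
  have hnn : ∀ c, ∀ j ∈ Finset.range (N + 1), 0 ≤ (x (j + 1) - x j) ^ 2 -
      (if j < c then 1 else -1) * (x (j + 1) - x j) := fun c j _ => by
    generalize x (j + 1) - x j = d
    split_ifs
    · rcases le_or_gt d 0 with hd | hd <;> nlinarith
    · rcases lt_or_ge d 0 with hd | hd <;> nlinarith
  have hTn : ∀ j ∈ Finset.range N, 0 ≤ x (j + 1) * (x j + x (j + 2) +
      (if j + 1 = b then 1 else 0) + (if j + 1 = a then 1 else 0) - 2 * x (j + 1)) := fun j hj => by
    obtain ⟨-, h1, h2⟩ := hh j (Finset.mem_range.1 hj)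
    rw [chainSource_zero_apply N b κ (Finset.mem_range.1 hj), hw] at h2
    exact mul_nonneg h1 (by omega)
  have sa := Finset.sum_nonneg (hnn a)
  have sb := Finset.sum_nonneg (hnn b)
  have sT := Finset.sum_nonneg hTn
  have ea := Finset.sum_sub_distrib (s := Finset.range (N + 1)) (fun j => (x (j + 1) - x j) ^ 2)
    fun j => (if j < a then 1 else -1) * (x (j + 1) - x j)
  have eb := Finset.sum_sub_distrib (s := Finset.range (N + 1)) (fun j => (x (j + 1) - x j) ^ 2)
    fun j => (if j < b then 1 else -1) * (x (j + 1) - x j)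
  rw [hsgn a ha] at ea
  rw [hsgn b hb] at eb
  -- The slack sum gives `∑ slope² ≤ x a + x b`, while `d² ≥ ± d` for integers gives `∑ slope² ≥ 2 x
  -- a` and `∑ slope² ≥ 2 x b`. Hence all are equalities, and every nonnegative summand vanishes.
  refine ⟨by linarith, fun j hj => ?_, fun j hj => ?_, fun j hj => ?_⟩
  · exact sub_eq_zero.1 ((Finset.sum_eq_zero_iff_of_nonneg (hnn a)).1 (by linarith) j
      (Finset.mem_range.2 (by omega)))
  · exact sub_eq_zero.1 ((Finset.sum_eq_zero_iff_of_nonneg (hnn b)).1 (by linarith) j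
      (Finset.mem_range.2 (by omega)))
  · exact (Finset.sum_eq_zero_iff_of_nonneg hTn).1 (by linarith) j (Finset.mem_range.2 hj)

theorem qBinomialHalf_eq_one {q : K} (hq : ∀ n : ℕ, 0 < n → q ^ n ≠ 1) {n m : ℤ} (hn : Even n)
    (h0 : 0 ≤ n) (h : m * (n - 2 * m) = 0) : qBinomialHalf q n m = 1 := by
  rw [qBinomialHalf, if_pos hn]
  rcases mul_eq_zero.1 h with rfl | h
  · exact qBinomial_zero_right hq (by omega)
  · rw [show n / 2 = m by omega]
    exact qBinomial_self hq (by omega)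

/-- Saturation makes the exponent `∑ slope² - 2 x b` zero, and each binomial has lower entry 0 or
equal to its upper entry. -/
theorem chainTerm_eq_one {t : K} (ht : ∀ n : ℕ, 0 < n → t ^ n ≠ 1) {N a b : ℕ} (ha : a ≤ N)
    (hb : b ≤ N) {κ : ℤ} {x : ℕ → ℤ} (h0 : x 0 = 0) (hN : x (N + 1) = 0)
    (h : chainTerm t N (Pi.single a 1) (chainSource N 0 b κ) x ≠ 0) :
    chainTerm t N (Pi.single a 1) (chainSource N 0 b κ) x = 1 := by
  obtain ⟨h1, -, -, h2⟩ := saturated_of_chainTerm_ne_zero ha hb h0 hN h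
  obtain ⟨h3, h4⟩ := chainTerm_ne_zero h
  have hu : ∑ j ∈ Finset.range (N + 2), chainSource N 0 b κ j * x j = x b := by
    have : ∀ j, chainSource N 0 b κ j * x j = x j * (Pi.single b 1 : ℕ → ℤ) j +
        x j * (Pi.single (N + 1) κ : ℕ → ℤ) j := fun j => by
      simp only [chainSource, Pi.single_zero, zero_add, Pi.add_apply]; ring
    simp only [this, Finset.sum_add_distrib]
    rw [sum_mul_single (by omega), sum_mul_single (by omega), hN]
    ring
  rw [chainTerm, if_pos h3, chainExponent, h1, hu, sub_self, zpow_zero, one_mul]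
  refine Finset.prod_eq_one fun j hj => ?_
  obtain ⟨h5, h6, h7⟩ := h4 j (Finset.mem_range.1 hj)
  refine qBinomialHalf_eq_one (pow_four_ne_one ht) h5 (by omega) ?_
  rw [chainSource_zero_apply N b κ (Finset.mem_range.1 hj), Pi.single_apply]
  exact h2 j (Finset.mem_range.1 hj)

/-- The shape of a nonzero summand without a source at the left end. -/
theorem shape_of_chainTerm_ne_zero {t : K} {N a b : ℕ} (ha : a ≤ N) (hb : b ≤ N) {κ : ℤ}
    (hκ : κ = 0 ∨ κ = 1) {x : ℕ → ℤ} (h0 : x 0 = 0) (hN : x (N + 1) = 0)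
    (h : chainTerm t N (Pi.single a 1) (chainSource N 0 b κ) x ≠ 0) :
    (κ = 0 → a = b ∧ ∀ i ≤ N + 1, x i = 0) ∧ (κ = 1 → a + b = N + 1 ∧
      ∀ i : ℕ, i ≤ N + 1 → x i = min (i : ℤ) (min a b) - max 0 ((i : ℤ) - max a b)) := by
  obtain ⟨-, ha', hb', -⟩ := saturated_of_chainTerm_ne_zero ha hb h0 hN h
  obtain ⟨h3, h4⟩ := chainTerm_ne_zero h
  have hw : ∀ j, (Pi.single a 1 : ℕ → ℤ) j = if j = a then 1 else 0 := fun j => Pi.single_apply ..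
  have h4' : ∀ j < N, Even (x j + x (j + 2) + (if j + 1 = b then 1 else 0) +
      (if j + 1 = a then 1 else 0)) := fun j hj => by
    have := (h4 j hj).1
    rwa [chainSource_zero_apply N b κ hj, hw] at this
  have hκN : chainSource N 0 b κ (N + 1) = κ := by
    simp [chainSource, show N + 1 ≠ b by omega]
  rw [hκN, Int.even_iff] at h3
  have hd : ∀ (c : ℕ) (d : ℤ) (j : ℕ), d ^ 2 = (if j < c then 1 else -1) * d →
      d = 0 ∨ (j < c ∧ d = 1) ∨ (c ≤ j ∧ d = -1) := fun c d j hcd => by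
    rcases lt_or_ge j c with hj | hj
    · rw [if_pos hj] at hcd
      have : d * (d - 1) = 0 := by linarith
      rcases mul_eq_zero.1 this with h' | h' <;> omega
    · rw [if_neg (by omega)] at hcd
      have : d * (d + 1) = 0 := by linarith
      rcases mul_eq_zero.1 this with h' | h' <;> omega
  -- Integrality of the upper entries says that the parity of the slope changes exactly when a
  -- source is passed.
  have hpar : ∀ j ≤ N, (x (j + 1) - x j - x 1 - (if 1 ≤ a ∧ a ≤ j then 1 else 0) -
      (if 1 ≤ b ∧ b ≤ j then 1 else 0)) % 2 = 0 := fun j => by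
    induction j with
    | zero => intro _; rw [if_neg (by omega), if_neg (by omega), h0]; simp
    | succ j ih =>
      intro hj
      have h5 := ih (by omega)
      have h6 := Int.even_iff.1 (h4' j (by omega))
      rw [show j + 1 + 1 = j + 2 from rfl]
      split_ifs at h5 h6 ⊢ <;> omega
  -- Signs from saturation and parities from integrality leave a trapezoid: slope `x 1`, then 0
  -- between the sources, then `-κ`.
  have hslope : ∀ j ≤ N, x (j + 1) - x j =
      if j < a ∧ j < b then x 1 else if j < a ∨ j < b then 0 else -κ := fun j hj => by
    have p1 := hpar j hj
    have p2 := hpar N le_rfl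
    have d1 := hd a _ j (ha' j hj)
    have d2 := hd b _ j (hb' j hj)
    have d3 := hd a _ 0 (ha' 0 (by omega))
    rw [h0, zero_add, sub_zero] at d3
    split_ifs at p1 p2 ⊢ <;> omega
  have hx1 : x 1 = 0 ∨ x 1 = 1 := by
    have d3 := hd a _ 0 (ha' 0 (by omega))
    have d4 : 0 ≤ x 1 := by
      rcases Nat.eq_zero_or_pos N with rfl | h5
      · exact hN.ge
      · exact (h4 0 h5).2.1
    rw [h0, zero_add, sub_zero] at d3
    omega
  have hform : ∀ i : ℕ, i ≤ N + 1 → x i = x 1 * min (i : ℤ) (min a b) -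
      κ * max 0 ((i : ℤ) - max a b) := fun i => by
    induction i with
    | zero => intro _; rw [h0]; simp
    | succ i ih =>
      intro hi
      have h5 := ih (by omega)
      have h6 := hslope i (by omega)
      rcases hκ with rfl | rfl <;> rcases hx1 with h7 | h7 <;> rw [h7] at h5 h6 ⊢ <;>
        push_cast <;> split_ifs at h6 <;> omega
  have hend := hform (N + 1) le_rfl
  rw [hN] at hend
  refine ⟨fun hκ0 => ?_, fun hκ1 => ?_⟩
  · subst hκ0
    have hx : ∀ i ≤ N + 1, x i = 0 := fun i hi => by
      have h5 := hform i hi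
      rcases hx1 with h7 | h7 <;> rw [h7] at h5 hend <;> push_cast at hend <;> omega
    refine ⟨?_, hx⟩
    by_contra hab
    -- For `x = 0` and `a ≠ b`, a site carrying a single unit source would have upper entry `1/2`.
    obtain ⟨j, hj, hj'⟩ : ∃ j < N, (j + 1 = a ∧ j + 1 ≠ b) ∨ (j + 1 ≠ a ∧ j + 1 = b) := by
      rcases Nat.eq_zero_or_pos a with h5 | h5
      · exact ⟨b - 1, by omega, by omega⟩
      · exact ⟨a - 1, by omega, by omega⟩
    have h6 := h4' j hj
    rw [hx j (by omega), hx (j + 2) (by omega), Int.even_iff] at h6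
    split_ifs at h6 <;> omega
  · subst hκ1
    rcases hx1 with h7 | h7
    · rw [h7] at hend; push_cast at hend; omega
    · rw [h7] at hend
      simp only [h7] at hform
      push_cast at hend
      refine ⟨by omega, fun i hi => ?_⟩
      rw [hform i hi]; ring

theorem qBinomialHalf_ne_zero_of {q : K} (hq : ∀ n : ℕ, 0 < n → q ^ n ≠ 1) {n m : ℤ}
    (hn : Even n) (h0 : 0 ≤ m) (h : 2 * m ≤ n) : qBinomialHalf q n m ≠ 0 := by
  rw [qBinomialHalf, if_pos hn, qBinomial, if_pos (by omega)]
  exact div_ne_zero (qPoch_self_ne_zero hq _)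
    (mul_ne_zero (qPoch_self_ne_zero hq _) (qPoch_self_ne_zero hq _))

theorem chainTerm_ne_zero_of {t : K} (ht0 : t ≠ 0) (ht : ∀ n : ℕ, 0 < n → t ^ n ≠ 1) {N : ℕ}
    {w u x : ℕ → ℤ} (h1 : Even (x N + u (N + 1)))
    (h2 : ∀ j < N, Even (x j + x (j + 2) + u (j + 1) + w (j + 1)) ∧
      0 ≤ x (j + 1) ∧ 2 * x (j + 1) ≤ x j + x (j + 2) + u (j + 1) + w (j + 1)) :
    chainTerm t N w u x ≠ 0 := by
  rw [chainTerm, if_pos h1]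
  refine mul_ne_zero (zpow_ne_zero _ ht0) (Finset.prod_ne_zero_iff.2 fun j hj => ?_)
  obtain ⟨h3, h4, h5⟩ := h2 j (Finset.mem_range.1 hj)
  exact qBinomialHalf_ne_zero_of (pow_four_ne_one ht) h3 h4 h5

theorem chainSum_eq_one {t : K} (ht : ∀ n : ℕ, 0 < n → t ^ n ≠ 1) {N a b : ℕ} (ha : a ≤ N)
    (hb : b ≤ N) {κ : ℤ} {m : Fin N → ℤ}
    (h : chainTerm t N (Pi.single a 1) (chainSource N 0 b κ) (chainExt m) ≠ 0)
    (h' : ∀ m' : Fin N → ℤ, chainTerm t N (Pi.single a 1) (chainSource N 0 b κ) (chainExt m') ≠ 0 →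
      ∀ i ≤ N + 1, chainExt m' i = chainExt m i) :
    chainSum t N (Pi.single a 1) (chainSource N 0 b κ) = 1 := by
  rw [chainSum, finsum_eq_single _ m]
  · exact chainTerm_eq_one ht ha hb (chainExt_zero m) (chainExt_of_lt m (by omega)) h
  · intro m' hm'
    by_contra h2
    refine hm' (funext fun j => ?_)
    rw [← chainExt_succ m' j, ← chainExt_succ m j]
    exact h' m' h2 _ (by omega)

theorem chainSum_zero_even {t : K} (ht0 : t ≠ 0) (ht : ∀ n : ℕ, 0 < n → t ^ n ≠ 1) {N a b : ℕ}
    (ha : a ≤ N) (hb : b ≤ N) :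
    chainSum t N (Pi.single a 1) (chainSource N 0 b 0) = if a = b then 1 else 0 := by
  have hs := fun (m : Fin N → ℤ) (h : chainTerm t N (Pi.single a 1) (chainSource N 0 b 0)
    (chainExt m) ≠ 0) => (shape_of_chainTerm_ne_zero ha hb (Or.inl rfl) (chainExt_zero m)
      (chainExt_of_lt m (by omega)) h).1 rfl
  split_ifs with hab
  · subst hab
    have h0 : ∀ i, chainExt (0 : Fin N → ℤ) i = 0 := fun i => by simp [chainExt]
    refine chainSum_eq_one ht ha hb (m := 0) (chainTerm_ne_zero_of ht0 ht ?_ fun j hj => ?_)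
      fun m h i hi => by rw [h0, (hs m h).2 i hi]
    · simp [h0, chainSource, show N + 1 ≠ a by omega]
    · rw [h0, h0, h0, chainSource_zero_apply N a 0 hj, Pi.single_apply, Int.even_iff]
      split_ifs <;> omega
  · refine finsum_eq_zero_of_forall_eq_zero fun m => ?_
    by_contra h
    exact hab (hs m h).1

theorem chainSum_zero_odd {t : K} (ht0 : t ≠ 0) (ht : ∀ n : ℕ, 0 < n → t ^ n ≠ 1) {N a b : ℕ}
    (ha : a ≤ N) (hb : b ≤ N) :
    chainSum t N (Pi.single a 1) (chainSource N 0 b 1) = if a + b = N + 1 then 1 else 0 := by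
  have hs := fun (m : Fin N → ℤ) (h : chainTerm t N (Pi.single a 1) (chainSource N 0 b 1)
    (chainExt m) ≠ 0) => (shape_of_chainTerm_ne_zero ha hb (Or.inr rfl) (chainExt_zero m)
      (chainExt_of_lt m (by omega)) h).2 rfl
  split_ifs with hab
  -- The trapezoid rising to `min a b` and falling after `max a b`; it returns to 0 at `N + 1`
  -- because `a + b = N + 1`.
  · let m : Fin N → ℤ := fun j =>
      min ((j : ℤ) + 1) (min a b) - max 0 ((j : ℤ) + 1 - max a b)
    have h0 : ∀ i ≤ N + 1, chainExt m i = min (i : ℤ) (min a b) - max 0 ((i : ℤ) - max a b) :=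
      fun i hi => by
        rw [chainExt]
        split_ifs with h
        · simp only [m]
          push_cast [Nat.cast_sub h.1]
          rw [sub_add_cancel]
        · omega
    refine chainSum_eq_one ht ha hb (m := m) (chainTerm_ne_zero_of ht0 ht ?_ fun j hj => ?_)
      fun m' h i hi => by rw [h0 i hi, (hs m' h).2 i hi]
    · rw [h0 N (by omega), Int.even_iff]
      simp only [chainSource, Pi.add_apply, Pi.single_eq_same]
      rw [Pi.single_eq_of_ne (show N + 1 ≠ b by omega)]
      simp only [Pi.single_zero, Pi.zero_apply]
      omega
    · rw [h0 j (by omega), h0 (j + 1) (by omega), h0 (j + 2) (by omega),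
        chainSource_zero_apply N b 1 hj, Pi.single_apply, Int.even_iff]
      push_cast
      split_ifs <;> omega
  · refine finsum_eq_zero_of_forall_eq_zero fun m => ?_
    by_contra h
    exact hab (hs m h).1

/-! ### Comparison of chain sums and bosonic sums -/

/-- The fermionic sum is the bosonic sum, for all sources and both parities at the right end. -/
theorem chainSum_eq_bosonicW {t : K} (ht0 : t ≠ 0) (ht : ∀ n : ℕ, 0 < n → t ^ n ≠ 1) {N a : ℕ}
    (hN : 1 ≤ N) (ha : a ≤ N) (M : ℕ) : ∀ b ≤ N + 1,
    t ^ ((M : ℤ) ^ 2) * chainSum t N (Pi.single a 1) (chainSource N M b 0) =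
      t ^ ((b : ℤ) - a + if b = 0 then 2 * (M : ℤ) else 0) *
        bosonicW t (N + 3) (a + 1) M (b + 1) ∧
    t ^ ((M : ℤ) ^ 2) * chainSum t N (Pi.single a 1) (chainSource N M b 1) =
      t ^ ((b : ℤ) - (N + 1 - a) + if b = 0 then 2 * (M : ℤ) else 0) *
        bosonicW t (N + 3) (N + 2 - a) M (b + 1) := by
  have hp : (0 : ℤ) < N + 3 := by positivity
  have hw : ∀ j, 0 ≤ (Pi.single a 1 : ℕ → ℤ) j := fun j => by
    rw [Pi.single_apply]; split_ifs <;> simp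
  -- the top value of `b` from the bottom value with the other parity
  have top : ∀ M : ℕ, (∀ b ≤ N,
      t ^ ((M : ℤ) ^ 2) * chainSum t N (Pi.single a 1) (chainSource N M b 0) =
        t ^ ((b : ℤ) - a + if b = 0 then 2 * (M : ℤ) else 0) *
          bosonicW t (N + 3) (a + 1) M (b + 1) ∧
      t ^ ((M : ℤ) ^ 2) * chainSum t N (Pi.single a 1) (chainSource N M b 1) =
        t ^ ((b : ℤ) - (N + 1 - a) + if b = 0 then 2 * (M : ℤ) else 0) *
          bosonicW t (N + 3) (N + 2 - a) M (b + 1)) → ∀ b ≤ N + 1,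
      t ^ ((M : ℤ) ^ 2) * chainSum t N (Pi.single a 1) (chainSource N M b 0) =
        t ^ ((b : ℤ) - a + if b = 0 then 2 * (M : ℤ) else 0) *
          bosonicW t (N + 3) (a + 1) M (b + 1) ∧
      t ^ ((M : ℤ) ^ 2) * chainSum t N (Pi.single a 1) (chainSource N M b 1) =
        t ^ ((b : ℤ) - (N + 1 - a) + if b = 0 then 2 * (M : ℤ) else 0) *
          bosonicW t (N + 3) (N + 2 - a) M (b + 1) := by
    intro M h b hb
    rcases hb.lt_or_eq with hb' | rfl
    · exact h b (by omega)
    · obtain ⟨h1, h2⟩ := h 0 (by omega)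
      obtain ⟨h3, h4⟩ := chainSum_source_top t (N := N) (Pi.single a 1) (M : ℤ)
      have h5 := bosonicW_top hp ht0 ht (a + 1) (M := M) (by positivity)
      have h6 := bosonicW_top hp ht0 ht (N + 2 - a) (M := M) (by positivity)
      rw [show ((N : ℤ) + 3 - (a + 1)) = N + 2 - a by ring] at h5
      rw [show ((N : ℤ) + 3 - (N + 2 - a)) = a + 1 by ring] at h6
      rw [if_pos rfl, Nat.cast_zero, zero_add] at h1 h2
      rw [h3, h4, h1, h2, if_neg (by omega)]
      push_cast
      rw [show (N : ℤ) + 1 + 1 = N + 3 - 1 by ring, h5, h6, ← mul_assoc, ← mul_assoc,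
        ← zpow_add₀ ht0, ← zpow_add₀ ht0]
      constructor <;> congr 2 <;> ring
  -- the induction step for one parity
  have step : ∀ (M : ℕ) (κ α : ℤ), (∀ b ≤ N + 1,
      t ^ ((M : ℤ) ^ 2) * chainSum t N (Pi.single a 1) (chainSource N M b κ) =
        t ^ ((b : ℤ) - α + if b = 0 then 2 * (M : ℤ) else 0) *
          bosonicW t (N + 3) (α + 1) M (b + 1)) →
      (∀ b ≤ N + 1, 2 ≤ b → 1 ≤ M →
        t ^ ((M - 1 : ℤ) ^ 2) * chainSum t N (Pi.single a 1) (chainSource N (M - 1) b κ) =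
          t ^ ((b : ℤ) - α) * bosonicW t (N + 3) (α + 1) (M - 1) (b + 1)) → ∀ b ≤ N,
      t ^ ((M + 1 : ℤ) ^ 2) * chainSum t N (Pi.single a 1) (chainSource N (M + 1) b κ) =
        t ^ ((b : ℤ) - α + if b = 0 then 2 * (M + 1 : ℤ) else 0) *
          bosonicW t (N + 3) (α + 1) (M + 1) (b + 1) := by
    intro M κ α h h' b hb
    have hM : (0 : ℤ) ≤ M := by positivity
    rcases b with _ | _ | b
    · have h1 := h 1 (by omega)
      rw [if_neg one_ne_zero, add_zero] at h1
      push_cast at h1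
      rw [if_pos rfl, chainSum_source_zero, Nat.cast_zero, zero_add, bosonicW_one ht0 ht _ _ hM,
        show (M + 1 : ℤ) ^ 2 = 2 * M + 1 + M ^ 2 by ring, zpow_add₀ ht0, mul_assoc, h1,
        ← mul_assoc, ← zpow_add₀ ht0]
      congr 2
      ring
    · have h1 := h 0 (by omega)
      have h2 := h 2 (by omega)
      have hW := bosonicW_rec hp ht (α + 1) hM 2
      rw [if_pos rfl, Nat.cast_zero, zero_sub, zero_add] at h1
      rw [if_neg two_ne_zero, add_zero, Nat.cast_two] at h2
      rw [if_neg (by omega), add_zero, zero_add, chainSum_source_one ht0 ht hN hw hM, Nat.cast_one,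
        one_add_one_eq_two]
      rw [show (2 : ℤ) - 1 = 1 by norm_num] at hW
      -- This lets the bosonic recurrence end at `b = 0` as the fermionic one does. `bosonicW_one`
      -- needs `M ≥ 1`; at `M = 0` the factor vanishes.
      have hz : (t ^ (4 * (M : ℤ)) - 1) * bosonicW t (N + 3) (α + 1) (M - 1) 2 =
          (t ^ (4 * (M : ℤ)) - 1) * bosonicW t (N + 3) (α + 1) M 1 := by
        rcases Nat.eq_zero_or_pos M with rfl | hM0
        · simp
        · have := bosonicW_one ht0 ht (N + 3) (α + 1) (M := (M : ℤ) - 1) (by omega)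
          rw [sub_add_cancel] at this
          rw [this]
      have e1 : t ^ ((M + 1 : ℤ) ^ 2) = t ^ (2 * M + 1 : ℤ) * t ^ ((M : ℤ) ^ 2) := by
        rw [← zpow_add₀ ht0]; congr 1; ring
      have e2 : t ^ ((M + 1 : ℤ) ^ 2) * t ^ (-2 * M - 2 : ℤ) = t ^ (-1 : ℤ) * t ^ ((M : ℤ) ^ 2) := by
        rw [← zpow_add₀ ht0, ← zpow_add₀ ht0]; congr 1; ring
      have e3 : t ^ (2 * M + 1 : ℤ) * t ^ (-α + 2 * (M : ℤ)) = t ^ (1 - α) * t ^ (4 * (M : ℤ)) := by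
        rw [← zpow_add₀ ht0, ← zpow_add₀ ht0]; congr 1; ring
      have e4 : t ^ (-1 : ℤ) * t ^ (2 - α) = t ^ (1 - α) := by
        rw [← zpow_add₀ ht0]; congr 1; ring
      linear_combination chainSum t N (Pi.single a 1) (chainSource N M 0 κ) * e1 +
        chainSum t N (Pi.single a 1) (chainSource N M 2 κ) * e2 + t ^ (2 * M + 1 : ℤ) * h1 +
        t ^ (-1 : ℤ) * h2 + bosonicW t (N + 3) (α + 1) M 1 * e3 +
        bosonicW t (N + 3) (α + 1) M (2 + 1) * e4 - t ^ (1 - α) * hW - t ^ (1 - α) * hz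
    · have h1 := h (b + 1) (by omega)
      have h2 := h (b + 3) (by omega)
      have hW := bosonicW_rec hp ht (α + 1) hM (b + 3)
      rw [if_neg (by omega), add_zero] at h1 h2
      rw [if_neg (by omega), add_zero, chainSum_source_rec ht0 ht (by omega) hb hw hM]
      -- At `M = 0` no hypothesis at `M - 1` is available, but the coefficient is zero.
      have h3 : (t ^ (4 * (M : ℤ)) - 1) * (t ^ ((M - 1 : ℤ) ^ 2) *
          chainSum t N (Pi.single a 1) (chainSource N (M - 1) (b + 1 + 1) κ)) =
          (t ^ (4 * (M : ℤ)) - 1) * (t ^ ((b : ℤ) + 2 - α) *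
            bosonicW t (N + 3) (α + 1) (M - 1) (b + 3)) := by
        rcases Nat.eq_zero_or_pos M with rfl | hM0
        · simp
        · rw [h' (b + 1 + 1) (by omega) (by omega) hM0]
          push_cast
          rw [add_assoc (b : ℤ) 1 1, one_add_one_eq_two, add_assoc (b : ℤ) 2 1]
          rfl
      push_cast at h1 h2 ⊢
      rw [add_assoc (b : ℤ) 1 1, one_add_one_eq_two] at h1 ⊢
      rw [add_assoc (b : ℤ) 3 1, show (3 : ℤ) + 1 = 4 by norm_num] at h2
      rw [add_assoc (b : ℤ) 2 1, show (2 : ℤ) + 1 = 3 by norm_num]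
      rw [add_assoc (b : ℤ) 3 1, show (3 : ℤ) + 1 = 4 by norm_num, add_sub_assoc (b : ℤ) 3 1,
        show (3 : ℤ) - 1 = 2 by norm_num] at hW
      have e1 : t ^ ((M + 1 : ℤ) ^ 2) * t ^ (-2 * M - 2 : ℤ) = t ^ (-1 : ℤ) * t ^ ((M : ℤ) ^ 2) := by
        rw [← zpow_add₀ ht0, ← zpow_add₀ ht0]; congr 1; ring
      have e2 : t ^ ((M + 1 : ℤ) ^ 2) * t ^ (-2 * M : ℤ) = t * t ^ ((M : ℤ) ^ 2) := by
        rw [← zpow_add₀ ht0, ← zpow_one_add₀ ht0]; congr 1; ring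
      have e3 : t ^ ((M + 1 : ℤ) ^ 2) = t ^ (4 * (M : ℤ)) * t ^ ((M - 1 : ℤ) ^ 2) := by
        rw [← zpow_add₀ ht0]; congr 1; ring
      have e4 : t ^ ((M + 1 : ℤ) ^ 2) * t ^ (-4 * M : ℤ) = t ^ ((M - 1 : ℤ) ^ 2) := by
        rw [← zpow_add₀ ht0]; congr 1; ring
      have e5 : t ^ (-1 : ℤ) * t ^ ((b : ℤ) + 3 - α) = t ^ ((b : ℤ) + 2 - α) := by
        rw [← zpow_add₀ ht0]; congr 1; ring
      have e6 : t * t ^ ((b : ℤ) + 1 - α) = t ^ ((b : ℤ) + 2 - α) := by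
        rw [← zpow_one_add₀ ht0]; congr 1; ring
      linear_combination
        chainSum t N (Pi.single a 1) (chainSource N M (b + 3) κ) * e1 +
        chainSum t N (Pi.single a 1) (chainSource N M (b + 1) κ) * e2 +
        chainSum t N (Pi.single a 1) (chainSource N (M - 1) (b + 1 + 1) κ) * (e3 - e4) +
        t ^ (-1 : ℤ) * h2 + t * h1 + h3 + bosonicW t (N + 3) (α + 1) M (b + 4) * e5 +
        bosonicW t (N + 3) (α + 1) M (b + 2) * e6 - t ^ ((b : ℤ) + 2 - α) * hW
  have base : ∀ b ≤ N + 1, _ := top 0 fun b hb => by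
    have e1 := bosonicW_zero ht (p := N + 3) (a := a + 1) (b := b + 1) (by omega) (by omega)
      (by omega) (by omega)
    have e2 := bosonicW_zero ht (p := N + 3) (a := N + 2 - a) (b := b + 1) (by omega) (by omega)
      (by omega) (by omega)
    rw [Nat.cast_zero, e1, e2, chainSum_zero_even ht0 ht ha hb, chainSum_zero_odd ht0 ht ha hb]
    simp only [mul_zero, ite_self, add_zero]
    norm_num
    constructor
    · split_ifs with h1
      · simp [h1]
      · rfl
    · by_cases h1 : a + b = N + 1
      · rw [if_pos h1, if_pos (by omega), show (b : ℤ) - (N + 1 - a) = 0 by omega, zpow_zero]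
      · rw [if_neg h1, if_neg (by omega)]
  -- The recurrence reaches back to both `M` and `M - 1`. The step is used with `α = a` for even and
  -- `α = N + 1 - a` for odd parity, and `top` then supplies `b = N + 1`.
  induction M using Nat.strong_induction_on with
  | _ M ih =>
    rcases M with _ | M
    · exact base
    · refine top (M + 1) fun b hb => ?_
      push_cast
      have s0 := step M 0 a (fun b hb => (ih M (by omega) b hb).1) (fun b hb hb2 hM => by
        have := (ih (M - 1) (by omega) b hb).1
        rw [if_neg (by omega), add_zero, Nat.cast_sub hM, Nat.cast_one] at this
        exact this) b hb
      have s1 := step M 1 (N + 1 - a) (fun b hb => by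
          rw [show (N + 1 - a + 1 : ℤ) = N + 2 - a by ring]
          exact (ih M (by omega) b hb).2) (fun b hb hb2 hM => by
        have := (ih (M - 1) (by omega) b hb).2
        rw [if_neg (by omega), add_zero, Nat.cast_sub hM, Nat.cast_one] at this
        rw [show (N + 1 - a + 1 : ℤ) = N + 2 - a by ring]
        exact this) b hb
      rw [show (N + 1 - a + 1 : ℤ) = N + 2 - a by ring] at s1
      exact ⟨s0, s1⟩

/-! ### Reduction of the fermionic forms to chains -/

theorem chainSource_apply (N : ℕ) (M : ℤ) (b j : ℕ) :
    chainSource N M b 0 (j + 1) = (if j = 0 then M else 0) + if j + 1 = b then 1 else 0 := by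
  simp [chainSource, Pi.single_apply]

/-- Integrality of the upper entries fixes `x` modulo 2 from the right end down to site 1. This is
why the parity shift in `u` makes the upper entry of `m₁` an integer. -/
theorem chainTerm_parity {t : K} {N a b : ℕ} (hN : 1 ≤ N) (ha : a ≤ N) (hb : b ≤ N + 1) {M : ℤ}
    {x : ℕ → ℤ} (hxN : x (N + 1) = 0)
    (h : chainTerm t N (Pi.single a 1) (chainSource N M b 0) x ≠ 0) :
    (x 1 - (if 1 < a ∧ a % 2 = 0 then 1 else 0) - if 1 < b ∧ b % 2 = 0 then 1 else 0) % 2 = 0 := by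
  obtain ⟨h1, h2⟩ := chainTerm_ne_zero h
  rw [chainSource_apply, if_neg (by omega), Int.even_iff] at h1
  have key : ∀ i, i + 1 ≤ N →
      (x (N - i) - (if N - i < a ∧ (a - (N - i)) % 2 = 1 then 1 else 0) -
        (if N - i < b ∧ (b - (N - i)) % 2 = 1 then 1 else 0)) % 2 = 0 ∧
      (x (N - i + 1) - (if N - i + 1 < a ∧ (a - (N - i + 1)) % 2 = 1 then 1 else 0) -
        (if N - i + 1 < b ∧ (b - (N - i + 1)) % 2 = 1 then 1 else 0)) % 2 = 0 := fun i => by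
    induction i with
    | zero =>
      intro _
      rw [Nat.sub_zero, hxN]
      split_ifs at h1 ⊢ <;> omega
    | succ i ih =>
      intro hi
      have h3 := ih (by omega)
      have h4 := (h2 (N - (i + 1)) (by omega)).1
      rw [chainSource_apply, if_neg (by omega), Pi.single_apply,
        Int.even_iff] at h4
      obtain ⟨k, hk⟩ : ∃ k, N - (i + 1) = k := ⟨_, rfl⟩
      rw [show N - i = k + 1 by omega] at h3
      rw [hk] at h4 ⊢
      rw [show k + 1 + 1 = k + 2 from rfl] at h3
      refine ⟨?_, h3.1⟩
      have h5 := h3.2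
      clear h3 ih h2 h1
      split_ifs at h4 h5 ⊢ <;> omega
  have h3 := (key (N - 1) (by omega)).1
  rw [show N - (N - 1) = 1 by omega] at h3
  split_ifs at h3 ⊢ <;> omega

/-- The source at site 1 acts like a boundary value `x 0 = M`. With this value the total of the unit
sources is at most 2, so `slope_le_of_second_difference` bounds the first slope by 1. -/
theorem chainTerm_first_le {t : K} {N a b : ℕ} (hN : 1 ≤ N) {M : ℤ} (hM : 0 ≤ M)
    {x : ℕ → ℤ} (hx0 : x 0 = 0) (hxN : x (N + 1) = 0)
    (h : chainTerm t N (Pi.single a 1) (chainSource N M b 0) x ≠ 0) : x 1 ≤ M + 1 := by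
  obtain ⟨-, h2⟩ := chainTerm_ne_zero h
  have hδ : ∀ c : ℕ, ∑ j ∈ Finset.range N, (if j + 1 = c then (1 : ℤ) else 0) ≤ 1 := fun c => by
    rcases c with _ | c
    · simp
    · simp only [Nat.add_right_cancel_iff, Finset.sum_ite_eq']
      split_ifs <;> simp
  have h3 := slope_le_of_second_difference (N := N) (x := Function.update x 0 M)
    (c := fun j => (if j + 1 = b then 1 else 0) + if j + 1 = a then 1 else 0)
    (fun j _ => by split_ifs <;> simp) (fun j hj => by
      have h4 := (h2 j hj).2.2
      rw [chainSource_apply, Pi.single_apply] at h4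
      rcases j with _ | j
      · rw [Function.update_of_ne (show 0 + 1 ≠ 0 by omega),
          Function.update_of_ne (show 0 + 2 ≠ 0 by omega), Function.update_self]
        rw [hx0, if_pos rfl] at h4
        omega
      · rw [Function.update_of_ne (show j + 1 + 1 ≠ 0 by omega),
          Function.update_of_ne (show j + 1 + 2 ≠ 0 by omega),
          Function.update_of_ne (show j + 1 ≠ 0 by omega)]
        rw [if_neg (by omega)] at h4
        omega) (fun j hj => by
      rcases j with _ | j
      · rwa [Function.update_self]
      · rw [Function.update_of_ne (by omega)]
        exact (h2 j (by omega)).2.1) (by rwa [Function.update_of_ne (by omega)]) (Nat.zero_le N)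
  rw [Function.update_of_ne (by omega), Function.update_self, Finset.sum_add_distrib] at h3
  have := hδ a
  have := hδ b
  rw [zero_add] at h3
  omega

theorem chainTerm_first_bound {t : K} {N a b : ℕ} (hN : 1 ≤ N) (ha : a ≤ N) (hb : b ≤ N + 1)
    {L M : ℤ} (hM : 0 ≤ M) (hML : M ≤ L) {x : ℕ → ℤ} (hx0 : x 0 = 0) (hxN : x (N + 1) = 0)
    (h : chainTerm t N (Pi.single a 1) (chainSource N M b 0) x ≠ 0) :
    ∃ n : ℕ, x 1 + parity (a + 1 + delta (a + 1) 1 + (b + 1) + delta (b + 1) 1) = n + n ∧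
      (n : ℤ) ≤ L := by
  have h1 := chainTerm_parity hN ha hb hxN h
  have h2 := chainTerm_first_le hN hM hx0 hxN h
  have h3 := ((chainTerm_ne_zero h).2 0 (by omega)).2.1
  rw [zero_add] at h3
  -- The bound `x 1 ≤ M + 1` is too weak when `L = 0`. At `M = 0` the known shape of the summands is
  -- used instead; for `b = N + 1` it would force `a = N + 1`.
  have h4 : M = 0 → x 1 = 0 := by
    rintro rfl
    rcases hb.lt_or_eq with hb' | rfl
    · exact ((shape_of_chainTerm_ne_zero ha (by omega) (Or.inl rfl) hx0 hxN h).1 rfl).2 1 (by omega)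
    · have e : ∀ i < N, chainSource N 0 (N + 1) 0 (i + 1) = chainSource N 0 0 1 (i + 1) :=
        fun i hi => by
          rw [chainSource_zero_apply N _ _ hi, chainSource_zero_apply N _ _ hi, if_neg (by omega),
            if_neg (by omega)]
      rw [chainTerm_congr t (u' := chainSource N 0 0 1) _ hx0 hxN e (by simp [chainSource])] at h
      have := ((shape_of_chainTerm_ne_zero ha (by omega) (Or.inr rfl) hx0 hxN h).2 rfl).1
      omega
  have h5 : parity (a + 1 + delta (a + 1) 1 + (b + 1) + delta (b + 1) 1) = 0 ∨
      parity (a + 1 + delta (a + 1) 1 + (b + 1) + delta (b + 1) 1) = 1 := by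
    rw [parity]; split_ifs <;> simp
  have h6 : (x 1 + parity (a + 1 + delta (a + 1) 1 + (b + 1) + delta (b + 1) 1)) % 2 = 0 := by
    simp only [parity, delta, Nat.odd_iff]
    split_ifs at h1 ⊢ <;> omega
  obtain ⟨n, hn⟩ := Int.eq_ofNat_of_zero_le
    (show 0 ≤ (x 1 + parity (a + 1 + delta (a + 1) 1 + (b + 1) + delta (b + 1) 1)) / 2 by omega)
  exact ⟨n, by omega, by omega⟩

theorem sum_ite_val_mul {n : ℕ} (c : ℕ) (v : Fin n → ℤ) :
    ∑ j : Fin n, (if (j : ℕ) = c then 1 else 0) * v j = if h : c < n then v ⟨c, h⟩ else 0 := by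
  split_ifs with h
  · rw [Finset.sum_eq_single ⟨c, h⟩]
    · simp
    · intro j _ hj
      rw [if_neg (fun h' => hj (Fin.ext h')), zero_mul]
    · simp
  · refine Finset.sum_eq_zero fun j _ => ?_
    rw [if_neg (by omega), zero_mul]

/-- The vector `(m₀, m₁, x_1, …, x_N)`. -/
def consVec {N : ℕ} (m₀ m₁ : ℤ) (x : Fin N → ℤ) : Fin (N + 3 - 1) → ℤ :=
  Fin.cons (n := N + 1) (α := fun _ => ℤ) m₀ (Fin.cons (n := N) (α := fun _ => ℤ) m₁ x)

theorem consVec_entries {N : ℕ} (m₀ m₁ : ℤ) (x : Fin N → ℤ) :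
    consVec m₀ m₁ x ⟨0, by omega⟩ = m₀ ∧ consVec m₀ m₁ x ⟨1, by omega⟩ = m₁ ∧
      ∀ (j : ℕ) (hj : j < N), consVec m₀ m₁ x ⟨j + 2, by omega⟩ = x ⟨j, hj⟩ :=
  ⟨rfl, rfl, fun _ _ => rfl⟩

theorem consVec_ext {N : ℕ} (m₀ m₁ : ℤ) (x : Fin N → ℤ) (c : ℕ) :
    (if h : c < N + 3 - 1 then consVec m₀ m₁ x ⟨c, h⟩ else 0) =
      if c = 0 then m₀ else if c = 1 then m₁ else chainExt x (c - 1) := by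
  obtain ⟨h0, h1, h2⟩ := consVec_entries m₀ m₁ x
  rcases c with _ | _ | c
  · rw [dif_pos (by omega), h0, if_pos rfl]
  · rw [dif_pos (by omega), if_neg (by omega), if_pos (by omega)]
    exact h1
  · rw [if_neg (by omega), if_neg (by omega)]
    rcases lt_or_ge c N with hc | hc
    · rw [dif_pos (by omega), h2 c hc]
      exact (chainExt_succ x ⟨c, hc⟩).symm
    · rw [dif_neg (by omega), chainExt_of_lt x (by omega)]

/-- The pair `(m₀, m₁)` reaches the chain only as the source `m₀ + m₁` at its first site, and feels
back only `∓ x₁`. -/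
theorem incidence_mulVec_consVec {N : ℕ} (m₀ m₁ : ℤ) (x : Fin N → ℤ) :
    ((incidence (N + 3)).mulVec (consVec m₀ m₁ x)) ⟨0, by omega⟩ = -chainExt x 1 ∧
    ((incidence (N + 3)).mulVec (consVec m₀ m₁ x)) ⟨1, by omega⟩ = chainExt x 1 ∧
    ∀ (j : ℕ) (hj : j < N), ((incidence (N + 3)).mulVec (consVec m₀ m₁ x)) ⟨j + 2, by omega⟩ =
      (if j = 0 then m₀ + m₁ else 0) + chainExt x j + chainExt x (j + 2) := by
  have hs := fun c => (sum_ite_val_mul c (consVec m₀ m₁ x)).trans (consVec_ext m₀ m₁ x c)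
  refine ⟨?_, ?_, fun j hj => ?_⟩
  · have e : ∀ i : Fin (N + 3 - 1), incidence (N + 3) ⟨0, by omega⟩ i * consVec m₀ m₁ x i =
        -((if (i : ℕ) = 2 then 1 else 0) * consVec m₀ m₁ x i) := fun i => by
      simp only [incidence]; split_ifs <;> simp
    simp only [Matrix.mulVec, dotProduct, e, Finset.sum_neg_distrib]
    rw [hs]; rfl
  · have e : ∀ i : Fin (N + 3 - 1), incidence (N + 3) ⟨1, by omega⟩ i * consVec m₀ m₁ x i =
        (if (i : ℕ) = 2 then 1 else 0) * consVec m₀ m₁ x i := fun i => by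
      simp only [incidence]; split_ifs <;> first | contradiction | omega
    simp only [Matrix.mulVec, dotProduct, e]
    rw [hs]; rfl
  · have e : ∀ i : Fin (N + 3 - 1), incidence (N + 3) ⟨j + 2, by omega⟩ i * consVec m₀ m₁ x i =
        (if (i : ℕ) = 0 then 1 else 0) * ((if j = 0 then 1 else 0) * consVec m₀ m₁ x i) +
        (if (i : ℕ) = j + 1 then 1 else 0) * consVec m₀ m₁ x i +
        (if (i : ℕ) = j + 3 then 1 else 0) * consVec m₀ m₁ x i := fun i => by
      simp only [incidence]; split_ifs <;> first | contradiction | omega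
    simp only [Matrix.mulVec, dotProduct, e, Finset.sum_add_distrib]
    rw [hs, hs]
    have := sum_ite_val_mul 0 fun i => (if j = 0 then 1 else 0) * consVec m₀ m₁ x i
    rw [this, dif_pos (by omega), (consVec_entries m₀ m₁ x).1]
    rcases j with _ | j
    · simp [chainExt_zero]
    · simp

theorem sum_univ_consVec {N : ℕ} {R : Type*} [AddCommMonoid R] (f : Fin (N + 3 - 1) → R) :
    ∑ i, f i = f ⟨0, by omega⟩ + (f ⟨1, by omega⟩ + ∑ j : Fin N, f ⟨j + 2, by omega⟩) :=
  (Fin.sum_univ_succ (n := N + 1) f).trans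
    (congrArg _ (Fin.sum_univ_succ (n := N) fun i => f (Fin.succ (n := N + 1) i)))

theorem prod_univ_consVec {N : ℕ} {R : Type*} [CommMonoid R] (f : Fin (N + 3 - 1) → R) :
    ∏ i, f i = f ⟨0, by omega⟩ * (f ⟨1, by omega⟩ * ∏ j : Fin N, f ⟨j + 2, by omega⟩) :=
  (Fin.prod_univ_succ (n := N + 1) f).trans
    (congrArg _ (Fin.prod_univ_succ (n := N) fun i => f (Fin.succ (n := N + 1) i)))

/-- The parity of `a + δ_{a,1} + b + δ_{b,1}` for heights shifted by one. -/
def sourceParity (a b : ℕ) : ℤ := parity (a + 1 + delta (a + 1) 1 + (b + 1) + delta (b + 1) 1)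

theorem thetaVec_apply (p a : ℕ) (j : Fin (p - 1)) :
    thetaVec p (a + 1) j = if (j : ℕ) = a + 1 ∧ 0 < a then 1 else 0 := by
  rw [thetaVec]
  split_ifs <;> simp [unitVec] <;> omega

theorem parity_source (N a b : ℕ) : parity (a + 1 + delta (a + 1) 1 + (b + 1) + delta (b + 1) 1 +
    delta 0 1 * (N + 3 - 1)) = sourceParity a b := by
  rw [show delta 0 1 = 0 from rfl, zero_mul, add_zero, sourceParity]

theorem uVec_entries (N a b : ℕ) :
    uVec (N + 3) 0 (a + 1) (b + 1) ⟨0, by omega⟩ = -sourceParity a b ∧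
    uVec (N + 3) 0 (a + 1) (b + 1) ⟨1, by omega⟩ = sourceParity a b ∧
    ∀ (j : ℕ) (hj : j < N), uVec (N + 3) 0 (a + 1) (b + 1) ⟨j + 2, by omega⟩ =
      (if j + 1 = a then 1 else 0) + if j + 1 = b then 1 else 0 := by
  simp only [uVec, parity_source, Pi.add_apply, thetaVec_apply, Pi.smul_apply, Pi.sub_apply, unitVec]
  refine ⟨?_, ?_, fun j hj => ?_⟩
  · simp
  · simp; split_ifs <;> omega
  · simp; split_ifs <;> omega

theorem aVec_entries (N a b : ℕ) :
    aVec (N + 3) 0 (a + 1) (b + 1) ⟨0, by omega⟩ = 0 ∧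
    aVec (N + 3) 0 (a + 1) (b + 1) ⟨1, by omega⟩ = sourceParity a b ∧
    ∀ (j : ℕ) (hj : j < N), aVec (N + 3) 0 (a + 1) (b + 1) ⟨j + 2, by omega⟩ =
      if j + 1 = b then 1 else 0 := by
  simp only [aVec, parity_source, Pi.add_apply, thetaVec_apply, Pi.smul_apply, unitVec]
  refine ⟨?_, ?_, fun j hj => ?_⟩
  · simp
  · simp
  · simp
    omega

theorem chainExponent_source {N : ℕ} (hN : 1 ≤ N) {b : ℕ} (hb : b ≤ N + 1) (M : ℤ) (x : Fin N → ℤ) :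
    chainExponent N (chainSource N M b 0) (chainExt x) =
      ∑ j : Fin N, x j * (2 * x j - chainExt x j - chainExt x (j + 2)) -
        2 * (M * chainExt x 1 + chainExt x b) := by
  rw [chainExponent, sum_sq_slope, chainExt_zero, chainExt_of_lt x (Nat.lt_succ_self N)]
  have hu : ∑ j ∈ Finset.range (N + 2), chainSource N M b 0 j * chainExt x j =
      M * chainExt x 1 + chainExt x b := by
    have : ∀ j, chainSource N M b 0 j * chainExt x j = chainExt x j * (Pi.single 1 M : ℕ → ℤ) j +
        chainExt x j * (Pi.single b 1 : ℕ → ℤ) j := fun j => by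
      simp only [chainSource, Pi.single_zero, Pi.zero_apply, add_zero, Pi.add_apply]; ring
    simp only [this, Finset.sum_add_distrib]
    rw [sum_mul_single (by omega), sum_mul_single (by omega)]
    ring
  rw [hu, Finset.sum_range]
  simp only [chainExt_succ]
  ring

/-- The summand of the fermionic form in terms of chain summands. -/
theorem fermionicTerm_consVec {t : K} (ht0 : t ≠ 0) {N a b : ℕ} (hN : 1 ≤ N) (hb : b ≤ N + 1)
    (L : ℕ) (m₀ m₁ : ℤ) (x : Fin N → ℤ) :
    fermionicTerm t (N + 3) (fIndex (N + 3) 0 (b + 1)) L (uVec (N + 3) 0 (a + 1) (b + 1))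
      (aVec (N + 3) 0 (a + 1) (b + 1)) (consVec m₀ m₁ x) =
    qBinomialHalf (t ^ 4) (2 * L - (chainExt x 1 + sourceParity a b)) m₀ *
      qBinomialHalf (t ^ 4) (chainExt x 1 + sourceParity a b) m₁ *
      t ^ (2 * (m₀ + m₁) ^ 2 - 2 * sourceParity a b * (m₀ + m₁) +
        2 * m₀ * (chainExt x 1 + sourceParity a b) - 4 * m₀ * m₁) *
      chainTerm t N (Pi.single a 1) (chainSource N (m₀ + m₁) b 0) (chainExt x) := by
  obtain ⟨c0, c1, c2⟩ := consVec_entries m₀ m₁ x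
  obtain ⟨i0, i1, i2⟩ := incidence_mulVec_consVec m₀ m₁ x
  obtain ⟨u0, u1, u2⟩ := uVec_entries N a b
  obtain ⟨a0, a1, a2⟩ := aVec_entries N a b
  -- For `b = N + 1` the index `k` is 1, matched by the unit source at `N + 1` in the chain.
  have hcond : (∀ j : Fin (N + 3 - 1), (j : ℕ) + 2 = N + 3 →
      consVec m₀ m₁ x j ≡ fIndex (N + 3) 0 (b + 1) [ZMOD 2]) ↔
      Even (chainExt x N + chainSource N (m₀ + m₁) b 0 (N + 1)) := by
    have e1 : consVec m₀ m₁ x ⟨N + 1, by omega⟩ = chainExt x N := by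
      obtain ⟨n, rfl⟩ : ∃ n, N = n + 1 := ⟨N - 1, by omega⟩
      rw [c2 n (by omega)]
      exact (chainExt_succ x ⟨n, by omega⟩).symm
    have e2 : (∀ j : Fin (N + 3 - 1), (j : ℕ) + 2 = N + 3 →
        consVec m₀ m₁ x j ≡ fIndex (N + 3) 0 (b + 1) [ZMOD 2]) ↔
        chainExt x N ≡ fIndex (N + 3) 0 (b + 1) [ZMOD 2] := by
      rw [← e1]
      refine ⟨fun h => h _ (by simp), fun h j hj => ?_⟩
      rw [show j = ⟨N + 1, by omega⟩ from Fin.ext (by simp; omega)]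
      exact h
    rw [e2, chainSource_apply, if_neg (by omega), Int.even_iff, fIndex, Int.ModEq]
    push_cast
    split_ifs <;> omega
  -- Here `2 m₀² + 2 m₁² = 2 (m₀ + m₁)² - 4 m₀ m₁`; the part not fixed by `m₀ + m₁` and `x` is the
  -- Vandermonde exponent.
  have hexp : consVec m₀ m₁ x ⬝ᵥ (cartan (N + 3)).mulVec (consVec m₀ m₁ x) -
      2 * (aVec (N + 3) 0 (a + 1) (b + 1) ⬝ᵥ consVec m₀ m₁ x) =
      (2 * (m₀ + m₁) ^ 2 - 2 * sourceParity a b * (m₀ + m₁) +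
        2 * m₀ * (chainExt x 1 + sourceParity a b) - 4 * m₀ * m₁) +
      chainExponent N (chainSource N (m₀ + m₁) b 0) (chainExt x) := by
    rw [cartan, Matrix.sub_mulVec, Matrix.smul_mulVec, Matrix.one_mulVec, chainExponent_source hN hb]
    simp only [dotProduct, sum_univ_consVec, Pi.sub_apply, Pi.smul_apply, c0, c1, i0, i1, a0, a1]
    have s1 : ∑ j : Fin N, consVec m₀ m₁ x ⟨j + 2, by omega⟩ *
        ((2 : ℤ) • consVec m₀ m₁ x ⟨j + 2, by omega⟩ -
          ((incidence (N + 3)).mulVec (consVec m₀ m₁ x)) ⟨j + 2, by omega⟩) =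
        ∑ j : Fin N, x j * (2 * x j - chainExt x j - chainExt x (j + 2)) -
          (m₀ + m₁) * chainExt x 1 := by
      have e : ∑ j : Fin N, (if (j : ℕ) = 0 then 1 else 0) * x j = chainExt x 1 := by
        rw [sum_ite_val_mul, dif_pos (by omega)]
        exact (chainExt_succ x ⟨0, by omega⟩).symm
      rw [← e, Finset.mul_sum, ← Finset.sum_sub_distrib]
      refine Finset.sum_congr rfl fun j _ => ?_
      rw [c2 j j.2, i2 j j.2]
      simp only [smul_eq_mul]
      split_ifs <;> ring
    have s2 : ∑ j : Fin N, aVec (N + 3) 0 (a + 1) (b + 1) ⟨j + 2, by omega⟩ *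
        consVec m₀ m₁ x ⟨j + 2, by omega⟩ = chainExt x b := by
      rcases b with _ | b
      · rw [chainExt_zero]
        refine Finset.sum_eq_zero fun j _ => ?_
        rw [a2 j j.2, if_neg (by omega), zero_mul]
      · have e : ∀ j : Fin N, aVec (N + 3) 0 (a + 1) (b + 1 + 1) ⟨j + 2, by omega⟩ *
            consVec m₀ m₁ x ⟨j + 2, by omega⟩ = (if (j : ℕ) = b then 1 else 0) * x j := fun j => by
          rw [a2 j j.2, c2 j j.2]
          simp only [Nat.add_right_cancel_iff]
        simp only [e]
        rw [sum_ite_val_mul]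
        split_ifs with h
        · exact (chainExt_succ x ⟨b, h⟩).symm
        · rw [chainExt_of_lt x (by omega)]
    rw [s1, s2]
    simp only [smul_eq_mul]
    ring
  rw [fermionicTerm, chainTerm]
  simp only [hcond]
  split_ifs with h
  · rw [hexp, zpow_add₀ ht0, prod_univ_consVec]
    simp only [Pi.add_apply, Pi.smul_apply, c0, c1, i0, i1, u0, u1]
    have hp : ∏ j : Fin N, qBinomialHalf (t ^ 4)
        (((incidence (N + 3)).mulVec (consVec m₀ m₁ x)) ⟨j + 2, by omega⟩ +
          (2 * (L : ℤ)) • unitVec (N + 3) 0 ⟨j + 2, by omega⟩ +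
          uVec (N + 3) 0 (a + 1) (b + 1) ⟨j + 2, by omega⟩) (consVec m₀ m₁ x ⟨j + 2, by omega⟩) =
        ∏ j ∈ Finset.range N, qBinomialHalf (t ^ 4) (chainExt x j + chainExt x (j + 2) +
          chainSource N (m₀ + m₁) b 0 (j + 1) + (Pi.single a 1 : ℕ → ℤ) (j + 1))
          (chainExt x (j + 1)) := by
      rw [Finset.prod_range]
      refine Finset.prod_congr rfl fun j _ => ?_
      rw [i2 j j.2, u2 j j.2, c2 j j.2, chainSource_apply, Pi.single_apply, chainExt_succ]
      congr 1
      simp only [unitVec]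
      simp
      ring
    rw [hp]
    simp only [unitVec]
    rw [if_neg one_ne_zero]
    simp only [if_true, smul_eq_mul, mul_one, mul_zero, add_zero]
    rw [show -chainExt x 1 + 2 * (L : ℤ) + -sourceParity a b =
      2 * L - (chainExt x 1 + sourceParity a b) by ring]
    ring
  · simp

theorem qBinomialHalf_add_self (q : K) (n m : ℤ) : qBinomialHalf q (n + n) m = qBinomial q n m := by
  rw [qBinomialHalf, if_pos ⟨n, rfl⟩, show (n + n) / 2 = n by omega]

/-- The `q`-Vandermonde sum over all integers. -/
theorem finsum_qBinomialHalf_vandermonde {t : K} (ht0 : t ≠ 0) (ht : ∀ n : ℕ, 0 < n → t ^ n ≠ 1)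
    {L n : ℕ} (h : n ≤ L) (M : ℤ) :
    ∑ᶠ i : ℤ, qBinomialHalf (t ^ 4) (2 * L - ((n : ℤ) + n)) i *
      qBinomialHalf (t ^ 4) ((n : ℤ) + n) (M - i) *
      t ^ (2 * i * ((n : ℤ) + n) - 4 * i * (M - i)) = qBinomial (t ^ 4) L M := by
  obtain ⟨l, rfl⟩ := Nat.exists_eq_add_of_le' h
  have hv := qBinomial_vandermonde (pow_four_ne_one ht) (pow_ne_zero 4 ht0) l n M
  push_cast
  rw [← hv, show 2 * ((l : ℤ) + n) - (n + n) = l + l by ring]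
  simp only [qBinomialHalf_add_self]
  rw [finsum_eq_sum_of_support_subset (s := (Finset.range (l + 1)).map Nat.castEmbedding),
    Finset.sum_map]
  · refine Finset.sum_congr rfl fun i _ => ?_
    rw [Nat.castEmbedding_apply, pow_four_zpow,
      show 2 * (i : ℤ) * (n + n) - 4 * i * (M - i) = 4 * (i * (n - (M - i))) by ring]
    ring
  · intro i hi
    have h1 : qBinomial (t ^ 4) l i ≠ 0 := left_ne_zero_of_mul (left_ne_zero_of_mul hi)
    have h2 : 0 ≤ i := by
      by_contra h'
      exact h1 (qBinomial_of_neg _ (by omega))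
    have h3 : i ≤ l := by
      by_contra h'
      exact h1 (qBinomial_of_lt _ (by omega))
    simp only [Finset.coe_map, Set.mem_image, Finset.mem_coe, Finset.mem_range,
      Nat.castEmbedding_apply]
    exact ⟨i.toNat, by omega, by omega⟩

/-- The parametrization of vectors by the sum of the first two entries, the remaining entries
and the first entry. -/
def consEquiv (N : ℕ) : (ℤ × (Fin N → ℤ)) × ℤ ≃ (Fin (N + 3 - 1) → ℤ) where
  toFun z := consVec z.2 (z.1.1 - z.2) z.1.2
  invFun v := ((v ⟨0, by omega⟩ + v ⟨1, by omega⟩, fun j => v ⟨j + 2, by omega⟩), v ⟨0, by omega⟩)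
  left_inv z := by
    obtain ⟨⟨M, x⟩, m⟩ := z
    obtain ⟨c0, c1, c2⟩ := consVec_entries m (M - m) x
    simp only [c0, c1, add_sub_cancel]
    congr
  right_inv v := by
    funext i
    obtain ⟨c0, c1, c2⟩ := consVec_entries (v ⟨0, by omega⟩)
      (v ⟨0, by omega⟩ + v ⟨1, by omega⟩ - v ⟨0, by omega⟩) fun j : Fin N => v ⟨j + 2, by omega⟩
    obtain ⟨i, hi⟩ := i
    rcases i with _ | _ | i
    · exact c0
    · exact c1.trans (by ring)
    · exact c2 i (by omega)

theorem finite_support_chainTerm_prod (t : K) (N a b L : ℕ) :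
    (Set.Icc (0 : ℤ) L ×ˢ ⋃ M ∈ Set.Icc (0 : ℤ) L, Function.support fun x : Fin N → ℤ =>
      chainTerm t N (Pi.single a 1) (chainSource N M b 0) (chainExt x)).Finite :=
  (Set.finite_Icc _ _).prod ((Set.finite_Icc _ _).biUnion fun _ _ =>
    hasFiniteSupport_chainTerm t N _ _)

/-- The upper entries of the first two binomials add up to `L`, which bounds `m₀ + m₁`. -/
theorem fermionicTerm_consEquiv_ne_zero {t : K} (ht0 : t ≠ 0) {N a b : ℕ} (hN : 1 ≤ N)
    (hb : b ≤ N + 1) {L : ℕ} {z : (ℤ × (Fin N → ℤ)) × ℤ}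
    (h : fermionicTerm t (N + 3) (fIndex (N + 3) 0 (b + 1)) L (uVec (N + 3) 0 (a + 1) (b + 1))
      (aVec (N + 3) 0 (a + 1) (b + 1)) (consEquiv N z) ≠ 0) :
    (0 ≤ z.1.1 ∧ z.1.1 ≤ L) ∧ (0 ≤ z.2 ∧ z.2 ≤ L) ∧
      chainTerm t N (Pi.single a 1) (chainSource N z.1.1 b 0) (chainExt z.1.2) ≠ 0 := by
  change fermionicTerm _ _ _ _ _ _ (consVec z.2 (z.1.1 - z.2) z.1.2) ≠ 0 at h
  rw [fermionicTerm_consVec ht0 hN hb, add_sub_cancel] at h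
  have h1 := (qBinomialHalf_ne_zero (left_ne_zero_of_mul (left_ne_zero_of_mul
    (left_ne_zero_of_mul h)))).2
  have h2 := (qBinomialHalf_ne_zero (right_ne_zero_of_mul (left_ne_zero_of_mul
    (left_ne_zero_of_mul h)))).2
  exact ⟨by omega, by omega, right_ne_zero_of_mul h⟩

theorem hasFiniteSupport_fermionicTerm_consEquiv {t : K} (ht0 : t ≠ 0) {N a b : ℕ} (hN : 1 ≤ N)
    (hb : b ≤ N + 1) (L : ℕ) : Function.HasFiniteSupport fun z : (ℤ × (Fin N → ℤ)) × ℤ =>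
    fermionicTerm t (N + 3) (fIndex (N + 3) 0 (b + 1)) L (uVec (N + 3) 0 (a + 1) (b + 1))
      (aVec (N + 3) 0 (a + 1) (b + 1)) (consEquiv N z) := by
  refine ((finite_support_chainTerm_prod t N a b L).prod (Set.finite_Icc (0 : ℤ) L)).subset
    fun z hz => ?_
  obtain ⟨h1, h2, h3⟩ := fermionicTerm_consEquiv_ne_zero ht0 hN hb hz
  refine ⟨⟨h1, ?_⟩, h2⟩
  simp only [Set.mem_iUnion]
  exact ⟨z.1.1, h1, h3⟩

theorem fermionicTerm_finite {t : K} (ht0 : t ≠ 0) {N a b : ℕ} (hN : 1 ≤ N) (hb : b ≤ N + 1)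
    (L : ℕ) : (Function.support (fermionicTerm t (N + 3) (fIndex (N + 3) 0 (b + 1)) L
      (uVec (N + 3) 0 (a + 1) (b + 1)) (aVec (N + 3) 0 (a + 1) (b + 1)))).Finite := by
  refine ((hasFiniteSupport_fermionicTerm_consEquiv (a := a) ht0 hN hb L).image (consEquiv N)).subset
    fun v hv => ⟨(consEquiv N).symm v, ?_, (consEquiv N).apply_symm_apply v⟩
  change fermionicTerm _ _ _ _ _ _ (consEquiv N ((consEquiv N).symm v)) ≠ 0
  rwa [(consEquiv N).apply_symm_apply v]

/-- Summation over the first entry with the sum of the first two entries fixed. -/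
theorem finsum_fermionicTerm_consEquiv {t : K} (ht0 : t ≠ 0) (ht : ∀ n : ℕ, 0 < n → t ^ n ≠ 1)
    {N a b : ℕ} (hN : 1 ≤ N) (ha : a ≤ N) (hb : b ≤ N + 1) (L : ℕ) (z : ℤ × (Fin N → ℤ)) :
    ∑ᶠ i : ℤ, fermionicTerm t (N + 3) (fIndex (N + 3) 0 (b + 1)) L
      (uVec (N + 3) 0 (a + 1) (b + 1)) (aVec (N + 3) 0 (a + 1) (b + 1)) (consEquiv N (z, i)) =
    t ^ (2 * z.1 ^ 2 - 2 * sourceParity a b * z.1) * qBinomial (t ^ 4) L z.1 *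
      chainTerm t N (Pi.single a 1) (chainSource N z.1 b 0) (chainExt z.2) := by
  by_cases hz : (0 ≤ z.1 ∧ z.1 ≤ L) ∧
      chainTerm t N (Pi.single a 1) (chainSource N z.1 b 0) (chainExt z.2) ≠ 0
  · obtain ⟨⟨h1, h2⟩, h3⟩ := hz
    obtain ⟨n, hn, hnL⟩ := chainTerm_first_bound hN ha hb h1 h2 (chainExt_zero _)
      (chainExt_of_lt _ (Nat.lt_succ_self N)) h3
    rw [← finsum_qBinomialHalf_vandermonde ht0 ht (show n ≤ L by omega) z.1, mul_finsum, finsum_mul]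
    refine finsum_congr fun i => ?_
    change fermionicTerm _ _ _ _ _ _ (consVec i (z.1 - i) z.2) = _
    rw [fermionicTerm_consVec ht0 hN hb, add_sub_cancel, sourceParity, hn, add_sub_assoc,
      zpow_add₀ ht0]
    ring
  · rw [finsum_eq_zero_of_forall_eq_zero]
    · by_cases h3 : chainTerm t N (Pi.single a 1) (chainSource N z.1 b 0) (chainExt z.2) = 0
      · rw [h3, mul_zero]
      · have h4 : qBinomial (t ^ 4) L z.1 = 0 := by
          rcases lt_or_ge z.1 0 with h5 | h5
          · exact qBinomial_of_neg _ h5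
          · exact qBinomial_of_lt _ (by_contra fun h6 => hz ⟨⟨h5, by omega⟩, h3⟩)
        rw [h4, mul_zero, zero_mul]
    · intro i
      by_contra h
      obtain ⟨h1, -, h3⟩ := fermionicTerm_consEquiv_ne_zero ht0 hN hb h
      exact hz ⟨h1, h3⟩

/-- The fermionic forms as transforms of sums over chains. -/
theorem fermionicF_eq_sum_chainSum {t : K} (ht0 : t ≠ 0) (ht : ∀ n : ℕ, 0 < n → t ^ n ≠ 1)
    {N a b : ℕ} (hN : 1 ≤ N) (ha : a ≤ N) (hb : b ≤ N + 1) (L : ℕ) :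
    fermionicF t (N + 3) 0 (a + 1) (b + 1) L = ∑ M ∈ Finset.range (L + 1),
      t ^ (2 * (M : ℤ) ^ 2 - 2 * sourceParity a b * M) * qBinomial (t ^ 4) L M *
        chainSum t N (Pi.single a 1) (chainSource N M b 0) := by
  rw [fermionicF, fermionicForm, ← finsum_comp_equiv (consEquiv N),
    finsum_curry _ (hasFiniteSupport_fermionicTerm_consEquiv ht0 hN hb L),
    finsum_congr (finsum_fermionicTerm_consEquiv ht0 ht hN ha hb L), finsum_curry]
  · simp only [← mul_finsum]
    rw [finsum_eq_sum_of_support_subset (s := (Finset.range (L + 1)).map Nat.castEmbedding),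
      Finset.sum_map]
    · rfl
    · intro M hM
      have h1 : qBinomial (t ^ 4) L M ≠ 0 := right_ne_zero_of_mul (left_ne_zero_of_mul hM)
      have h2 : 0 ≤ M := by
        by_contra h'
        exact h1 (qBinomial_of_neg _ (by omega))
      have h3 : M ≤ L := by
        by_contra h'
        exact h1 (qBinomial_of_lt _ (by omega))
      simp only [Finset.coe_map, Set.mem_image, Finset.mem_coe, Finset.mem_range,
        Nat.castEmbedding_apply]
      exact ⟨M.toNat, by omega, by omega⟩
  · refine (finite_support_chainTerm_prod t N a b L).subset fun z hz => ?_
    have h1 : qBinomial (t ^ 4) L z.1 ≠ 0 := right_ne_zero_of_mul (left_ne_zero_of_mul hz)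
    have h2 : 0 ≤ z.1 := by
      by_contra h'
      exact h1 (qBinomial_of_neg _ (by omega))
    have h3 : z.1 ≤ L := by
      by_contra h'
      exact h1 (qBinomial_of_lt _ (by omega))
    refine ⟨⟨h2, h3⟩, ?_⟩
    simp only [Set.mem_iUnion]
    exact ⟨z.1, ⟨h2, h3⟩, right_ne_zero_of_mul hz⟩

/-! ### The identities -/

theorem sum_qBinomial_mul_bosonicW {t : K} (ht0 : t ≠ 0) (ht : ∀ n : ℕ, 0 < n → t ^ n ≠ 1)
    {p : ℤ} (hp : 0 < p) (n : ℤ) (L : ℕ) (a b : ℤ) :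
    ∑ M ∈ Finset.range (L + 1), t ^ ((M : ℤ) ^ 2 - 2 * n * M) * qBinomial (t ^ 4) L M *
      bosonicW t p a M b =
    ∑ᶠ j : ℤ, (t ^ (4 * (j * (p * j - p + a)) +
        ((2 * p * j + a - b) ^ 2 - 2 * n * (2 * p * j + a - b))) *
          qTrinomial (t ^ 4) n L (2 * p * j + a - b) -
      t ^ (4 * ((j + 1) * (p * j + a)) +
        ((2 * p * j + a + b) ^ 2 - 2 * n * (2 * p * j + a + b))) *
          qTrinomial (t ^ 4) n L (2 * p * j + a + b)) := by
  have := sum_qBinomial_mul_towers ht0 ht hp n L (fun j => 4 * (j * (p * j - p + a)))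
    (fun j => 4 * ((j + 1) * (p * j + a))) (a - b) (a + b)
  simpa only [bosonicW, ← add_sub_assoc, ← add_assoc] using this

theorem zpow_mul_zpow_sub_zpow {t : K} (ht0 : t ≠ 0) {x y e₁ e₂ f₁ f₂ : ℤ} (X Y : K)
    (h₁ : x + e₁ = y + 4 * f₁) (h₂ : x + e₂ = y + 4 * f₂) :
    t ^ x * (t ^ e₁ * X - t ^ e₂ * Y) = t ^ y * ((t ^ 4) ^ f₁ * X - (t ^ 4) ^ f₂ * Y) := by
  rw [mul_sub, mul_sub, ← mul_assoc, ← mul_assoc, ← mul_assoc, ← mul_assoc, pow_four_zpow,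
    pow_four_zpow, ← zpow_add₀ ht0, ← zpow_add₀ ht0, ← zpow_add₀ ht0, ← zpow_add₀ ht0, h₁, h₂]

theorem sum_qBinomial_mul_bosonicW_eq_bosonicB {t : K} (ht0 : t ≠ 0)
    (ht : ∀ n : ℕ, 0 < n → t ^ n ≠ 1) {p : ℕ} (hp : 0 < p) (L : ℕ) (a b : ℤ) :
    t ^ (b - a) * ∑ M ∈ Finset.range (L + 1), t ^ ((M : ℤ) ^ 2) * qBinomial (t ^ 4) L M *
      bosonicW t p a M b = t ^ phi4 a b * bosonicB (t ^ 4) p a b L (b + 1) := by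
  have h := sum_qBinomial_mul_bosonicW ht0 ht (p := p) (by omega) 0 L a b
  simp only [mul_zero, zero_mul, sub_zero] at h
  rw [h, bosonicB, mul_finsum, mul_finsum]
  refine finsum_congr fun j => ?_
  rw [bosonicTerm]
  exact zpow_mul_zpow_sub_zpow ht0 _ _ (by rw [phi4]; ring) (by rw [phi4]; ring)

theorem sum_qBinomial_mul_bosonicW_eq_bosonicBTilde {t : K} (ht0 : t ≠ 0)
    (ht : ∀ n : ℕ, 0 < n → t ^ n ≠ 1) {p : ℕ} (hp : 0 < p) (L : ℕ) (a b : ℤ) :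
    t ^ (b - a) * ∑ M ∈ Finset.range (L + 1), t ^ ((M : ℤ) ^ 2 - 2 * 1 * M) *
      qBinomial (t ^ 4) L M * bosonicW t p a M b =
        t ^ phiTilde4 a b * bosonicBTilde (t ^ 4) p a b L (b + 2) := by
  rw [sum_qBinomial_mul_bosonicW ht0 ht (p := p) (by omega) 1 L a b, bosonicBTilde, mul_finsum,
    mul_finsum]
  refine finsum_congr fun j => ?_
  rw [bosonicTildeTerm]
  exact zpow_mul_zpow_sub_zpow ht0 _ _ (by rw [phiTilde4]; ring) (by rw [phiTilde4]; ring)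

/-- The extra `t ^ (2 M)` would change the superscript of the trinomials; `bosonicW_one_eq` absorbs
it into the tower weights, so that the superscript stays 0. -/
theorem sum_qBinomial_mul_bosonicW_one {t : K} (ht0 : t ≠ 0)
    (ht : ∀ n : ℕ, 0 < n → t ^ n ≠ 1) {p : ℕ} (hp : 0 < p) (L : ℕ) (a : ℤ) :
    t ^ (1 - a) * ∑ M ∈ Finset.range (L + 1), t ^ ((M : ℤ) ^ 2) * qBinomial (t ^ 4) L M *
      (t ^ (2 * (M : ℤ)) * bosonicW t p a M 1) =
        t ^ (a * (a - 1)) * bosonicB (t ^ 4) p a 1 L 1 := by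
  have h := sum_qBinomial_mul_towers ht0 ht (p := p) (by omega) 0 L (fun j => 4 * (j * (p * j + a)))
    (fun j => 4 * (j * (p * j + a))) (a - 1) (a + 1)
  simp only [mul_zero, zero_mul, sub_zero, ← add_sub_assoc, ← add_assoc] at h
  have h1 : ∀ M : ℕ, t ^ ((M : ℤ) ^ 2) * qBinomial (t ^ 4) L M *
      (t ^ (2 * (M : ℤ)) * bosonicW t p a M 1) = t ^ (2 * (a - 1)) * (t ^ ((M : ℤ) ^ 2) *
      qBinomial (t ^ 4) L M * ∑ᶠ j : ℤ, (t ^ (4 * (j * (p * j + a))) *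
        centredBinomial t M (2 * p * j + a - 1) -
          t ^ (4 * (j * (p * j + a))) * centredBinomial t M (2 * p * j + a + 1))) := fun M => by
    rw [bosonicW_one_eq ht0 ht _ _ (by positivity)]; ring
  simp only [h1]
  rw [← Finset.mul_sum, h, bosonicB, ← mul_assoc, ← zpow_add₀ ht0, mul_finsum, mul_finsum]
  refine finsum_congr fun j => ?_
  rw [bosonicTerm]
  exact zpow_mul_zpow_sub_zpow ht0 _ _ (by ring) (by ring)

/-- The fermionic forms as transforms of bosonic sums. -/
theorem fermionicF_eq_sum_bosonicW {t : K} (ht0 : t ≠ 0) (ht : ∀ n : ℕ, 0 < n → t ^ n ≠ 1)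
    {N a b : ℕ} (hN : 1 ≤ N) (ha : a ≤ N) (hb : b ≤ N + 1) (L : ℕ) :
    fermionicF t (N + 3) 0 (a + 1) (b + 1) L = t ^ ((b : ℤ) - a) * ∑ M ∈ Finset.range (L + 1),
      t ^ ((M : ℤ) ^ 2 - 2 * sourceParity a b * M) * qBinomial (t ^ 4) L M *
        (t ^ (if b = 0 then 2 * (M : ℤ) else 0) * bosonicW t (N + 3) (a + 1) M (b + 1)) := by
  rw [fermionicF_eq_sum_chainSum ht0 ht hN ha hb, Finset.mul_sum]
  refine Finset.sum_congr rfl fun M _ => ?_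
  have h := (chainSum_eq_bosonicW ht0 ht hN ha M b hb).1
  rw [zpow_add₀ ht0] at h
  rw [show 2 * (M : ℤ) ^ 2 - 2 * sourceParity a b * M =
    (M ^ 2 - 2 * sourceParity a b * M) + M ^ 2 by ring, zpow_add₀ ht0]
  linear_combination t ^ ((M : ℤ) ^ 2 - 2 * sourceParity a b * M) * qBinomial (t ^ 4) L M * h

theorem sourceParity_of_even {a b : ℕ}
    (h : Even (a + 1 + delta (a + 1) 1 + (b + 1) + delta (b + 1) 1)) : sourceParity a b = 0 := by
  rw [sourceParity, parity, if_neg (Nat.not_odd_iff_even.2 h)]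

theorem sourceParity_of_odd {a b : ℕ}
    (h : Odd (a + 1 + delta (a + 1) 1 + (b + 1) + delta (b + 1) 1)) : sourceParity a b = 1 := by
  rw [sourceParity, parity, if_pos h]

theorem fermionicF_one_of_even {t : K} (ht0 : t ≠ 0) (ht : ∀ n : ℕ, 0 < n → t ^ n ≠ 1)
    {N a : ℕ} (hN : 1 ≤ N) (ha : a ≤ N) (L : ℕ) (h : Even (a + 1 + delta (a + 1) 1)) :
    fermionicF t (N + 3) 0 (a + 1) 1 L = t ^ (((a + 1 : ℕ) : ℤ) * ((a + 1 : ℕ) - 1)) *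
      bosonicB (t ^ 4) (N + 3) ((a + 1 : ℕ) : ℤ) 1 L 1 := by
  have h1 := fermionicF_eq_sum_bosonicW ht0 ht hN ha (Nat.zero_le (N + 1)) L
  have h2 := sum_qBinomial_mul_bosonicW_one ht0 ht (p := N + 3) (by omega) L ((a + 1 : ℕ) : ℤ)
  rw [sourceParity_of_even (by
    rw [show delta (0 + 1) 1 = 1 from rfl, add_assoc]; exact h.add ⟨1, rfl⟩)] at h1
  rw [← h2]
  simp only [if_true, mul_zero, zero_mul, sub_zero, Nat.cast_zero, zero_add] at h1
  rw [h1]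
  push_cast
  rw [show (1 : ℤ) - (a + 1) = 0 - a by ring]

theorem fermionicF_one_of_odd {t : K} (ht0 : t ≠ 0) (ht : ∀ n : ℕ, 0 < n → t ^ n ≠ 1)
    {N a : ℕ} (hN : 1 ≤ N) (ha : a ≤ N) (L : ℕ) (h : Odd (a + 1 + delta (a + 1) 1)) :
    fermionicF t (N + 3) 0 (a + 1) 1 L = t ^ ((((a + 1 : ℕ) : ℤ) - 1) * ((a + 1 : ℕ) - 2)) *
      bosonicB (t ^ 4) (N + 3) ((a + 1 : ℕ) : ℤ) 1 L 2 := by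
  have h1 := fermionicF_eq_sum_bosonicW ht0 ht hN ha (Nat.zero_le (N + 1)) L
  have h2 := sum_qBinomial_mul_bosonicW_eq_bosonicB ht0 ht (p := N + 3) (by omega) L
    ((a + 1 : ℕ) : ℤ) 1
  rw [sourceParity_of_odd (by
    rw [show delta (0 + 1) 1 = 1 from rfl, add_assoc]; exact h.add_even ⟨1, rfl⟩)] at h1
  rw [show phi4 ((a + 1 : ℕ) : ℤ) 1 = (((a + 1 : ℕ) : ℤ) - 1) * ((a + 1 : ℕ) - 2) by
    rw [phi4]; ring, one_add_one_eq_two] at h2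
  rw [← h2]
  simp only [if_true, Nat.cast_zero, zero_add] at h1
  rw [h1]
  push_cast
  rw [show (1 : ℤ) - (a + 1) = 0 - a by ring]
  congr 1
  refine Finset.sum_congr rfl fun M _ => ?_
  -- The boundary factor at `b = 0` cancels the shift due to odd parity, so `bosonicB` appears and
  -- not `bosonicBTilde`.
  have e : t ^ ((M : ℤ) ^ 2 - 2 * M) * t ^ (2 * (M : ℤ)) = t ^ ((M : ℤ) ^ 2) := by
    rw [← zpow_add₀ ht0]; congr 1; ring
  rw [← e]; ring

theorem fermionicF_of_even {t : K} (ht0 : t ≠ 0) (ht : ∀ n : ℕ, 0 < n → t ^ n ≠ 1)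
    {N a b : ℕ} (hN : 1 ≤ N) (ha : a ≤ N) (hb0 : 0 < b) (hb : b ≤ N + 1) (L : ℕ)
    (h : Even (b + 1 + (a + 1) + delta (a + 1) 1)) :
    fermionicF t (N + 3) 0 (a + 1) (b + 1) L = t ^ phi4 ((a + 1 : ℕ) : ℤ) ((b + 1 : ℕ) : ℤ) *
      bosonicB (t ^ 4) (N + 3) ((a + 1 : ℕ) : ℤ) ((b + 1 : ℕ) : ℤ) L ((b + 1 : ℕ) + 1) := by
  have h1 := fermionicF_eq_sum_bosonicW ht0 ht hN ha hb L
  have h2 := sum_qBinomial_mul_bosonicW_eq_bosonicB ht0 ht (p := N + 3) (by omega) L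
    ((a + 1 : ℕ) : ℤ) ((b + 1 : ℕ) : ℤ)
  rw [sourceParity_of_even (by
    rw [show delta (b + 1) 1 = 0 from if_neg (by omega), add_zero]
    rwa [add_comm, ← add_assoc] )] at h1
  rw [← h2, h1]
  simp only [if_neg hb0.ne', mul_zero, zero_mul, sub_zero, zpow_zero, one_mul]
  push_cast
  rw [add_sub_add_right_eq_sub]

theorem fermionicF_of_odd {t : K} (ht0 : t ≠ 0) (ht : ∀ n : ℕ, 0 < n → t ^ n ≠ 1)
    {N a b : ℕ} (hN : 1 ≤ N) (ha : a ≤ N) (hb0 : 0 < b) (hb : b ≤ N + 1) (L : ℕ)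
    (h : Odd (b + 1 + (a + 1) + delta (a + 1) 1)) :
    fermionicF t (N + 3) 0 (a + 1) (b + 1) L = t ^ phiTilde4 ((a + 1 : ℕ) : ℤ) ((b + 1 : ℕ) : ℤ) *
      bosonicBTilde (t ^ 4) (N + 3) ((a + 1 : ℕ) : ℤ) ((b + 1 : ℕ) : ℤ) L ((b + 1 : ℕ) + 2) := by
  have h1 := fermionicF_eq_sum_bosonicW ht0 ht hN ha hb L
  have h2 := sum_qBinomial_mul_bosonicW_eq_bosonicBTilde ht0 ht (p := N + 3) (by omega) L
    ((a + 1 : ℕ) : ℤ) ((b + 1 : ℕ) : ℤ)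
  rw [sourceParity_of_odd (by
    rw [show delta (b + 1) 1 = 0 from if_neg (by omega), add_zero]
    rwa [add_comm, ← add_assoc])] at h1
  rw [← h2, h1]
  simp only [if_neg hb0.ne', zpow_zero, one_mul]
  push_cast
  rw [add_sub_add_right_eq_sub]

end PhiTwoOne

/-- Even identities, with `q = t ^ 4` for a nonzero element `t` of a field that is not a root of unity
(for instance the indeterminate of a field of rational functions). -/
theorem mainTheorem1 {K : Type*} [Field K] (t : K) (ht0 : t ≠ 0)
    (ht : ∀ n : ℕ, 0 < n → t ^ n ≠ 1) (p : ℕ) (hp : 4 ≤ p) (L : ℕ) :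
    (∀ a b : ℕ, 1 ≤ a → a ≤ p - 2 → 1 ≤ b → b ≤ p - 1 →
      (Function.support (PhiTwoOne.fermionicTerm t p (PhiTwoOne.fIndex p 0 b) L
        (PhiTwoOne.uVec p 0 a b) (PhiTwoOne.aVec p 0 a b))).Finite) ∧
    (∀ a : ℕ, 1 ≤ a → a ≤ p - 2 →
      (Even (a + PhiTwoOne.delta a 1) →
        PhiTwoOne.fermionicF t p 0 a 1 L =
          t ^ ((a : ℤ) * (a - 1)) * PhiTwoOne.bosonicB (t ^ 4) p a 1 L 1) ∧
      (Odd (a + PhiTwoOne.delta a 1) →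
        PhiTwoOne.fermionicF t p 0 a 1 L =
          t ^ (((a : ℤ) - 1) * (a - 2)) * PhiTwoOne.bosonicB (t ^ 4) p a 1 L 2)) ∧
    (∀ a b : ℕ, 1 ≤ a → a ≤ p - 2 → 2 ≤ b → b ≤ p - 1 →
      (Even (b + a + PhiTwoOne.delta a 1) →
        PhiTwoOne.fermionicF t p 0 a b L =
          t ^ PhiTwoOne.phi4 a b * PhiTwoOne.bosonicB (t ^ 4) p a b L (b + 1)) ∧
      (Odd (b + a + PhiTwoOne.delta a 1) →
        PhiTwoOne.fermionicF t p 0 a b L =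
          t ^ PhiTwoOne.phiTilde4 a b * PhiTwoOne.bosonicBTilde (t ^ 4) p a b L (b + 2))) ∧
    PhiTwoOne.fermionicForm t p 0 L 0 0 =
      ∑ᶠ j : ℤ,
        ((t ^ 4) ^ ((p : ℤ) * (p + 1) * j ^ 2 + j) *
            PhiTwoOne.qTrinomial (t ^ 4) 0 L (2 * p * j) -
          (t ^ 4) ^ ((j * (p : ℤ) + 1) * (j * (p + 1) + 1)) *
            PhiTwoOne.qTrinomial (t ^ 4) 0 L (2 * p * j + 2)) := by
  obtain ⟨N, rfl⟩ : ∃ N, p = N + 3 := ⟨p - 3, by omega⟩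
  have hN : 1 ≤ N := by omega
  refine ⟨fun a b ha hap hb hbp => ?_, fun a ha hap => ?_, fun a b ha hap hb hbp => ?_, ?_⟩
  · obtain ⟨a, rfl⟩ := Nat.exists_eq_add_of_le' ha
    obtain ⟨b, rfl⟩ := Nat.exists_eq_add_of_le' hb
    exact PhiTwoOne.fermionicTerm_finite ht0 hN (by omega) L
  · obtain ⟨a, rfl⟩ := Nat.exists_eq_add_of_le' ha
    exact ⟨PhiTwoOne.fermionicF_one_of_even ht0 ht hN (by omega) L,
      PhiTwoOne.fermionicF_one_of_odd ht0 ht hN (by omega) L⟩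
  · obtain ⟨a, rfl⟩ := Nat.exists_eq_add_of_le' ha
    obtain ⟨b, rfl⟩ := Nat.exists_eq_add_of_le' (show 1 ≤ b by omega)
    exact ⟨PhiTwoOne.fermionicF_of_even ht0 ht hN (by omega) (by omega) (by omega) L,
      PhiTwoOne.fermionicF_of_odd ht0 ht hN (by omega) (by omega) (by omega) L⟩
  · have h := PhiTwoOne.fermionicF_one_of_even ht0 ht hN (Nat.zero_le N) L ⟨1, rfl⟩
    have hu : PhiTwoOne.uVec (N + 3) 0 1 1 = 0 := by
      simp [PhiTwoOne.uVec, PhiTwoOne.thetaVec, PhiTwoOne.parity, PhiTwoOne.delta,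
        show ¬ Odd 4 by decide]
    have hA : PhiTwoOne.aVec (N + 3) 0 1 1 = 0 := by
      simp [PhiTwoOne.aVec, PhiTwoOne.thetaVec, PhiTwoOne.parity, PhiTwoOne.delta,
        show ¬ Odd 4 by decide]
    have hf : PhiTwoOne.fIndex (N + 3) 0 1 = 0 := by
      rw [PhiTwoOne.fIndex, if_neg (by omega)]; rfl
    rw [zero_add, PhiTwoOne.fermionicF, hu, hA, hf] at h
    rw [h, PhiTwoOne.bosonicB, Nat.cast_one, sub_self, mul_zero, zpow_zero, one_mul]
    refine finsum_congr fun j => ?_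
    rw [PhiTwoOne.bosonicTerm]
    congr 3 <;> ring
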